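/- Let $m=2^{\mathfrak m}$, $k+1=2^{\mathfrak k}$ with $k\ge 1$, $n=2^{\mathfrak n}$, $p=m(k+1)$ be powers of two ($\mathfrak m,\mathfrak k,\mathfrak n\in\mathbb N_0$), let $\mathfrak d\in\mathbb N_0$, $\alpha\ge 0$, $h>0$ and $\boldsymbol A\in\mathbb C^{n\times n}$. **The matrix.** Put $\beta_j=\frac{k+1-j}{j(2k+1-j)}$ for $1\le j\le k$, $\widetilde{\boldsymbol 1}=((-1)^{k+1},(-1)^k,\dots,-1)^T\in\mathbb R^{k+1}$, let $\boldsymbol e_1$ be the first unit vector of $\mathbb R^{k+1}$, $\widetilde{\boldsymbol T}=\frac1{\sqrt{k+1}}(\boldsymbol e_1\widetilde{\boldsymbol 1}^T)\otimes \boldsymbol I_n$, and for $\boldsymbol X\in\mathbb C^{n\times n}$ $$\boldsymbol W_k(\boldsymbol X)=\begin{bmatrix}\frac1{\sqrt{k+1}}\boldsymbol I_n&\frac1{\sqrt{k+1}}\boldsymbol I_n&\cdots&\frac1{\sqrt{k+1}}\boldsymbol I_n\\ \boldsymbol I_n&\beta_k\boldsymbol X\\&\ddots&\ddots\\&&\boldsymbol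 I_n&\beta_1\boldsymbol X\end{bmatrix},$$ $$\boldsymbol L_{m,k,p}(\boldsymbol X)=\begin{bmatrix}\boldsymbol W_k(\boldsymbol X)\\ \widetilde{\boldsymbol T}&\boldsymbol W_k(\boldsymbol X)\\&\ddots&\ddots\\&&\widetilde{\boldsymbol T}&\boldsymbol W_k(\boldsymbol X)\\&&&\frac{\widetilde{\boldsymbol 1}^T\otimes\boldsymbol I_n}{\sqrt{k+1}}&\frac{\boldsymbol I_n}{\sqrt{k+1}}\\&&&&-\boldsymbol I_n&\boldsymbol I_n\\&&&&&\ddots&\ddots\\&&&&&&-\boldsymbol I_n&\boldsymbol I_n\end{bmatrix},$$ with $m$ diagonal blocks $\boldsymbol W_k(\boldsymbol X)$ followed by $p$ block rows of height $n$. It is a matrix on $1+\mathfrak m+\mathfrak k+\mathfrak n$ qubits. **Block-encodings.** For $\gamma\ge0$, a $(\gamma,a)$-block-encoding of an $s$-qubit matrix $\boldsymbol M$ is an $(a+s)$-qubit unitary $U$ with $\boldsymbol M=\gamma(\langle 0^a|\otimes I)\,U\,(|0^a\rangle\otimes I)$. **Theorem.** There is a quantum circuit on $(\mathfrak d+5)+(1+\mathfrak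 m+\mathfrak k+\mathfrak n)$ qubits with an oracle on $\mathfrak d+\mathfrak n$ qubits, depending only on $\mathfrak m,\mathfrak k,\mathfrak n,\mathfrak d,\alpha,h$, such that for every $\boldsymbol A\in\mathbb C^{n\times n}$ and every $(\alpha,\mathfrak d)$-block-encoding $U_{\boldsymbol A}$ of $\boldsymbol A$, the circuit with oracle $U_{\boldsymbol A}$ is a $(4\max\{\alpha h,1\},\,\mathfrak d+5)$-block-encoding of $\boldsymbol L_{m,k,p}(\boldsymbol A h)$. The circuit makes exactly one query to the oracle (one use of the controlled $U_{\boldsymbol A}$, with a single control qubit), and besides this query it consists of at most $C\,(k+\log^{e}(mk))$ gates, each an arbitrary one-qubit gate or a CNOT gate. The constants $C\in\mathbb R$ and $e\in\mathbb N_0$ are absolute; in particular they do not depend on $\mathfrak m,\mathfrak k,\mathfrak n,\mathfrak d,\alpha,h,\boldsymbol A$ or $U_{\boldsymbol A}$. -/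

import Mathlib

/-! ### The encoded matrix -/

/-- `β_j = (k + 1 - j) / (j (2k + 1 - j))`, for `1 ≤ j ≤ k`: the quotient `d_j / d_{j-1}` of two
consecutive coefficients of the denominator of the `(k, k)` Padé approximation to `exp`. -/
noncomputable def padeBeta (k j : ℕ) : ℝ :=
  ((k : ℝ) + 1 - j) / (j * (2 * (k : ℝ) + 1 - j))

/-- The `(k+1) × (k+1)` block matrix `W_k(A)`.  Block row `0` is `(k+1)^{-1/2} (I, …, I)`, and block
row `r = 1, …, k` has `I` in block column `r - 1` and `β_{k+1-r} A` in block column `r`. -/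
noncomputable def padeW {n : ℕ} (k : ℕ) (A : Matrix (Fin n) (Fin n) ℂ) (r c : Fin (k + 1)) :
    Matrix (Fin n) (Fin n) ℂ :=
  if r = 0 then ((1 / Real.sqrt (k + 1) : ℝ) : ℂ) • (1 : Matrix (Fin n) (Fin n) ℂ)
  else if c.val + 1 = r.val then 1
  else if c = r then ((padeBeta k (k + 1 - r.val) : ℝ) : ℂ) • A
  else 0

/-- The `c`-th entry of the row `(k+1)^{-1/2} ((-1)^{k+1}, (-1)^k, …, -1)`. -/
noncomputable def padeSign (k : ℕ) (c : Fin (k + 1)) : ℂ :=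
  (-1) ^ (k + 1 - c.val) * ((1 / Real.sqrt (k + 1) : ℝ) : ℂ)

/-- The `n × n` blocks of `L_{m,k,p}(A)`.  The block rows and columns are numbered by
`(Fin m × Fin (k+1)) ⊕ Fin p`: first `m` groups of `k+1` blocks, then `p` single blocks.
* `W_k(A)` stands in the `m` diagonal positions of the first part, and the matrix whose first block
  row is `padeSign` (times `I`), and whose other block rows vanish, stands right below them;
* the first of the last `p` block rows is `padeSign` (times `I`) under the last `W_k(A)`, followed by
  `(k+1)^{-1/2} I` on the diagonal;
* the other ones have `I` on the diagonal and `-I` to the left of it. -/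
noncomputable def padeLBlock {n : ℕ} (m k p : ℕ) (A : Matrix (Fin n) (Fin n) ℂ) :
    (Fin m × Fin (k + 1)) ⊕ Fin p → (Fin m × Fin (k + 1)) ⊕ Fin p → Matrix (Fin n) (Fin n) ℂ
  | .inl (s, r), .inl (t, c) =>
      if s = t then padeW k A r c
      else if t.val + 1 = s.val ∧ r = 0 then padeSign k c • (1 : Matrix (Fin n) (Fin n) ℂ)
      else 0
  | .inl _, .inr _ => 0
  | .inr a, .inl (t, c) =>
      if a.val = 0 ∧ t.val + 1 = m then padeSign k c • (1 : Matrix (Fin n) (Fin n) ℂ) else 0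
  | .inr a, .inr b =>
      if a = b then
        (if a.val = 0 then ((1 / Real.sqrt (k + 1) : ℝ) : ℂ) • (1 : Matrix (Fin n) (Fin n) ℂ) else 1)
      else if b.val + 1 = a.val then -1
      else 0

/-- The position of a scalar row (or column) of `L_{m,k,p}(A)`: entry `i` of block `(s, r)` of the
first part is number `(s (k+1) + r) n + i`, entry `i` of block `a` of the second part is number
`(m (k+1) + a) n + i`. -/
def padeLIndex (m k p n : ℕ) :
    ((Fin m × Fin (k + 1)) ⊕ Fin p) × Fin n ≃ Fin ((m * (k + 1) + p) * n) :=
  (((finProdFinEquiv.sumCongr (Equiv.refl _)).trans finSumFinEquiv).prodCongr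
    (Equiv.refl _)).trans finProdFinEquiv

/-- The matrix `L_{m,k,p}(A)`. -/
noncomputable def padeL {n : ℕ} (m k p : ℕ) (A : Matrix (Fin n) (Fin n) ℂ) :
    Matrix (Fin ((m * (k + 1) + p) * n)) (Fin ((m * (k + 1) + p) * n)) ℂ :=
  Matrix.of fun x y =>
    padeLBlock m k p A ((padeLIndex m k p n).symm x).1 ((padeLIndex m k p n).symm y).1
      ((padeLIndex m k p n).symm x).2 ((padeLIndex m k p n).symm y).2

/-! ### Qubits and block-encodings -/

/-- Operators on qubits labelled by `Q`, in the computational basis: a basis state is a map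
`Q → Fin 2`. -/
abbrev QubitOp (Q : Type) : Type := Matrix (Q → Fin 2) (Q → Fin 2) ℂ

/-- `U` is an (exact) `(α, a)`-block-encoding of the `s`-qubit matrix `A` of size `N = 2 ^ s`:
`U` is a unitary on `a` ancilla qubits and `s` system qubits, and
`A = α (⟨0^a| ⊗ I) U (|0^a⟩ ⊗ I)`.  System qubit `i` holds the binary digit of weight `2 ^ i` of a
row or column number (`finFunctionFinEquiv`). -/
def IsBlockEncoding {N : ℕ} (α : ℝ) (a s : ℕ) (U : QubitOp (Fin a ⊕ Fin s))
    (A : Matrix (Fin N) (Fin N) ℂ) : Prop :=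
  0 ≤ α ∧ U ∈ Matrix.unitaryGroup (Fin a ⊕ Fin s → Fin 2) ℂ ∧
    ∃ hN : 2 ^ s = N, ∀ x y : Fin s → Fin 2,
      A (finCongr hN (finFunctionFinEquiv x)) (finCongr hN (finFunctionFinEquiv y)) =
        (α : ℂ) * U (Sum.elim (fun _ => 0) x) (Sum.elim (fun _ => 0) y)

/-! ### Circuits with an oracle -/

/-- The operator on the qubits `Q` that applies `V` to the qubits `w i` and nothing to the others. -/
def embedOp {Q R : Type} [Fintype Q] [DecidableEq Q] [Fintype R] (w : R ↪ Q) (V : QubitOp R) :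
    QubitOp Q :=
  Matrix.of fun x y =>
    if ∀ q, (∀ i, w i ≠ q) → x q = y q then V (x ∘ w) (y ∘ w) else 0

/-- The steps of a circuit on the qubits `Q` with an oracle that acts on qubits labelled by `R`. -/
inductive CircuitStep (Q R : Type) : Type
  /-- an arbitrary one-qubit gate -/
  | single (u : Matrix.unitaryGroup (Fin 2) ℂ) (q : Q)
  /-- a CNOT gate with control `c` and target `t` -/
  | cnot (c t : Q) (h : c ≠ t)
  /-- one use of the oracle on the qubits `w i`, controlled by one other qubit `c` -/
  | query (c : Q) (w : R ↪ Q) (h : ∀ i, w i ≠ c)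

/-- The operator of one step, when the oracle is `V`. -/
def CircuitStep.op {Q R : Type} [Fintype Q] [DecidableEq Q] [Fintype R] (V : QubitOp R) :
    CircuitStep Q R → QubitOp Q
  | .single u q => Matrix.of fun x y => if ∀ r, r ≠ q → x r = y r then u.val (x q) (y q) else 0
  | .cnot c t _ => Matrix.of fun x y => if x = Function.update y t (y t + y c) then 1 else 0
  | .query c w _ => Matrix.of fun x y =>
      if y c = 1 then embedOp w V x y else (1 : QubitOp Q) x y

/-- Whether a step is a query to the oracle. -/
def CircuitStep.isQuery {Q R : Type} : CircuitStep Q R → Bool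
  | .single _ _ => false
  | .cnot _ _ _ => false
  | .query _ _ _ => true

/-- The operator of a circuit (a list of steps, the first one being applied first), when the oracle
is `V`. -/
def circuitOp {Q R : Type} [Fintype Q] [DecidableEq Q] [Fintype R] (V : QubitOp R) :
    List (CircuitStep Q R) → QubitOp Q
  | [] => 1
  | g :: gs => circuitOp V gs * g.op V

/-- The number of queries in a circuit. -/
def queryCount {Q R : Type} (gs : List (CircuitStep Q R)) : ℕ :=
  gs.countP fun g => g.isQuery

/-- The number of gates (one-qubit gates and CNOT gates) in a circuit. -/
def gateCount {Q R : Type} (gs : List (CircuitStep Q R)) : ℕ :=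
  gs.countP fun g => !g.isQuery

namespace PadeCircuit

set_option linter.unusedSectionVars false

/-! ### Multiplexed one-qubit gates -/

section Gates

/-! Because `m` and `k + 1` are powers of two, the number of a block splits into binary fields:
`lows` (the position in a group of `k + 1` blocks), `high` (the group) and `top` (the first or the
second half). In these terms `L` is a sum of four operators, each of them a diagonal of real row
coefficients times something that has a cheap circuit (`padeLBlock_apply`).

The multiples of `A` come from the query. The identities below the diagonal are a cyclic shift of
the blocks. The uniform rows are first rows of a tensor power of rotations by `-π/4`, whose entries
there all equal `1/√(k+1)`; switching these rotations off in the second half yields the diagonal of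
that half. The rows of alternating signs are last rows of a similar tensor product, in which one
rotation is reversed; the shift carries the last row of a group to the first row of the next. Rows
in which the tensor product or the shift is wrong, the wrap-around included, receive the coefficient
`0`.

The four operators are added by two selector qubits between Hadamard gates, which costs the factor
`4` (`hadamard_sandwich_apply`, `total_apply`). A coefficient `c` is produced by rotating the qubit
`f` by `arccos c` and projecting on `f = 0`. This needs `|c| ≤ 1`, whence the division by `max (α h)
1`. A flag qubit restricts the single query to one value of the selectors.

The coefficients depend on the selectors, `top`, `lows` and on whether `high` vanishes, so their
rotation is uniformly controlled and costs `O(k)` gates (`synthRy_map`, `SynthRy.prod_decide`).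
Everything else is built from multiply controlled `X` gates, which commutators provide with
quadratically many gates (`synth_ctrl_pauliX`); the shift is then cubic in the number of block
qubits (`synth_ctrl_incr`). -/

lemma eq_update_of_agree {Q : Type} [DecidableEq Q] {q : Q} {x y : Q → Fin 2} (h : ∀ r, r ≠ q → x r = y r) :
    Function.update y q (x q) = x := by
  funext r
  by_cases hr : r = q
  · subst hr; simp
  · simp [hr, h r hr]

variable {Q R : Type} [Fintype Q] [DecidableEq Q] [Fintype R]

/-- The operator that applies to the qubit `q` the one-qubit operator `u y`, chosen by the
basis state `y` (meant to depend on the other qubits only). -/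
def mux (q : Q) (u : (Q → Fin 2) → Matrix (Fin 2) (Fin 2) ℂ) : QubitOp Q :=
  Matrix.of fun x y => if ∀ r, r ≠ q → x r = y r then u y (x q) (y q) else 0

/-- `u` does not depend on the qubit `q`. -/
def Indep {β : Type*} (q : Q) (u : (Q → Fin 2) → β) : Prop :=
  ∀ y b, u (Function.update y q b) = u y

lemma mux_apply_of_agree {q : Q} (u : (Q → Fin 2) → Matrix (Fin 2) (Fin 2) ℂ) {x y : Q → Fin 2}
    (h : ∀ r, r ≠ q → x r = y r) : mux q u x y = u y (x q) (y q) := by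
  simp only [mux, Matrix.of_apply, if_pos h]

lemma mux_apply_of_ne {q r : Q} (u : (Q → Fin 2) → Matrix (Fin 2) (Fin 2) ℂ) {x y : Q → Fin 2}
    (hr : r ≠ q) (h : x r ≠ y r) : mux q u x y = 0 := by
  simp only [mux, Matrix.of_apply]
  exact if_neg fun h' => h (h' r hr)

lemma mul_mux_apply (M : QubitOp Q) (q : Q) (u : (Q → Fin 2) → Matrix (Fin 2) (Fin 2) ℂ)
    (x y : Q → Fin 2) :
    (M * mux q u) x y = ∑ b, M x (Function.update y q b) * u y b (y q) := by
  rw [Matrix.mul_apply]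
  refine (Fintype.sum_of_injective (fun b => Function.update y q b)
    (Function.update_injective y q) _ _ ?_ ?_).symm
  · intro z hz
    rw [mul_eq_zero]; right
    simp only [mux, Matrix.of_apply]
    exact if_neg fun h => hz ⟨z q, eq_update_of_agree h⟩
  · intro b
    rw [mux_apply_of_agree]
    · simp
    · intro r hr; simp [hr]

/-- Only the two states that agree with `x` off `q` contribute. Independence of `q` allows the gate
to be read off at `x` instead of at the intermediate state. -/
lemma mux_mul_apply {q : Q} {u : (Q → Fin 2) → Matrix (Fin 2) (Fin 2) ℂ} (hu : Indep q u)
    (M : QubitOp Q) (x y : Q → Fin 2) :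
    (mux q u * M) x y = ∑ b, u x (x q) b * M (Function.update x q b) y := by
  rw [Matrix.mul_apply]
  refine (Fintype.sum_of_injective (fun b => Function.update x q b)
    (Function.update_injective x q) _ _ ?_ ?_).symm
  · intro z hz
    rw [mul_eq_zero]; left
    simp only [mux, Matrix.of_apply]
    exact if_neg fun h => hz ⟨z q, eq_update_of_agree fun r hr => (h r hr).symm⟩
  · intro b
    rw [mux_apply_of_agree]
    · simp [hu x b]
    · intro r hr; simp [hr]

/-- This reduces identities between circuits with one target to identities of `2 × 2` matrices, one
for each state of the other qubits. -/
lemma mux_mul_mux {q : Q} {u : (Q → Fin 2) → Matrix (Fin 2) (Fin 2) ℂ} (hu : Indep q u)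
    (v : (Q → Fin 2) → Matrix (Fin 2) (Fin 2) ℂ) :
    mux q u * mux q v = mux q fun y => u y * v y := by
  ext x y
  rw [mux_mul_apply hu]
  by_cases h : ∀ r, r ≠ q → x r = y r
  · rw [mux_apply_of_agree _ h, Matrix.mul_apply]
    refine Finset.sum_congr rfl fun b _ => ?_
    rw [mux_apply_of_agree]
    · rw [← hu y (x q), eq_update_of_agree h]; simp
    · intro r hr; simpa [hr] using h r hr
  · push Not at h
    obtain ⟨r, hr, hxy⟩ := h
    rw [mux_apply_of_ne _ hr hxy]
    refine Finset.sum_eq_zero fun b _ => ?_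
    rw [mux_apply_of_ne _ hr (by simpa [hr] using hxy), mul_zero]

lemma mux_one (q : Q) : mux q (fun _ => (1 : Matrix (Fin 2) (Fin 2) ℂ)) = 1 := by
  ext x y
  by_cases h : ∀ r, r ≠ q → x r = y r
  · rw [mux_apply_of_agree _ h, Matrix.one_apply, Matrix.one_apply]
    congr 1
    rw [eq_iff_iff]
    refine ⟨fun hq => ?_, fun hxy => by rw [hxy]⟩
    rw [← eq_update_of_agree h, hq, Function.update_eq_self]
  · push Not at h
    obtain ⟨r, hr, hxy⟩ := h
    rw [mux_apply_of_ne _ hr hxy, Matrix.one_apply_ne]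
    exact fun h' => hxy (by rw [h'])

lemma star_mux {q : Q} {u : (Q → Fin 2) → Matrix (Fin 2) (Fin 2) ℂ} (hu : Indep q u) :
    star (mux q u) = mux q fun y => star (u y) := by
  ext x y
  rw [Matrix.star_apply]
  by_cases h : ∀ r, r ≠ q → x r = y r
  · rw [mux_apply_of_agree _ h, mux_apply_of_agree _ fun r hr => (h r hr).symm, Matrix.star_apply,
      ← eq_update_of_agree h, hu]
  · push Not at h
    obtain ⟨r, hr, hxy⟩ := h
    rw [mux_apply_of_ne _ hr hxy, mux_apply_of_ne _ hr hxy.symm, star_zero]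

lemma mux_mem_unitaryGroup {q : Q} {u : (Q → Fin 2) → Matrix (Fin 2) (Fin 2) ℂ} (hu : Indep q u)
    (h : ∀ y, u y ∈ Matrix.unitaryGroup (Fin 2) ℂ) :
    mux q u ∈ Matrix.unitaryGroup (Q → Fin 2) ℂ := by
  rw [Matrix.mem_unitaryGroup_iff, star_mux hu, mux_mul_mux hu, ← mux_one q]
  congr 1
  funext y
  exact Matrix.mem_unitaryGroup_iff.1 (h y)

/-- The Pauli matrix `X`. -/
def pauliX : Matrix (Fin 2) (Fin 2) ℂ := !![0, 1; 1, 0]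

/-- The matrix of the rotation of the plane by `θ`. -/
noncomputable def ry (θ : ℝ) : Matrix (Fin 2) (Fin 2) ℂ :=
  !![(Real.cos θ : ℂ), -(Real.sin θ : ℂ); (Real.sin θ : ℂ), (Real.cos θ : ℂ)]

/-- The Hadamard matrix. -/
noncomputable def hadamard : Matrix (Fin 2) (Fin 2) ℂ :=
  !![((√2)⁻¹ : ℂ), ((√2)⁻¹ : ℂ); ((√2)⁻¹ : ℂ), -((√2)⁻¹ : ℂ)]

lemma pauliX_mul_self : pauliX * pauliX = 1 := by
  simp [pauliX, Matrix.one_fin_two]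

lemma pauliX_mem : pauliX ∈ Matrix.unitaryGroup (Fin 2) ℂ := by
  rw [Matrix.mem_unitaryGroup_iff]
  ext i j; fin_cases i <;> fin_cases j <;> simp [pauliX, Matrix.mul_apply, Fin.sum_univ_two]

lemma inv_sqrt_two_mul_self : ((√2 : ℝ) : ℂ)⁻¹ * ((√2 : ℝ) : ℂ)⁻¹ = 1 / 2 := by
  rw [← mul_inv, ← Complex.ofReal_mul, Real.mul_self_sqrt (by norm_num)]; norm_num

lemma hadamard_mul_self : hadamard * hadamard = 1 := by
  have := inv_sqrt_two_mul_self
  ext i j; fin_cases i <;> fin_cases j <;>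
    simp [hadamard, Matrix.mul_apply, Fin.sum_univ_two, this] <;> norm_num

lemma star_hadamard : star hadamard = hadamard := by
  ext i j; fin_cases i <;> fin_cases j <;> simp [hadamard]

lemma hadamard_mem : hadamard ∈ Matrix.unitaryGroup (Fin 2) ℂ := by
  rw [Matrix.mem_unitaryGroup_iff, star_hadamard, hadamard_mul_self]

lemma ry_mul_ry (a b : ℝ) : ry a * ry b = ry (a + b) := by
  ext i j; fin_cases i <;> fin_cases j <;>
    simp [ry, Matrix.mul_apply, Fin.sum_univ_two, Complex.cos_add, Complex.sin_add] <;> ring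

lemma ry_zero : ry 0 = 1 := by
  simp [ry, Matrix.one_fin_two]

lemma star_ry (a : ℝ) : star (ry a) = ry (-a) := by
  ext i j; fin_cases i <;> fin_cases j <;>
    simp [ry, -Complex.ofReal_cos, -Complex.ofReal_sin]

lemma ry_mem (a : ℝ) : ry a ∈ Matrix.unitaryGroup (Fin 2) ℂ := by
  rw [Matrix.mem_unitaryGroup_iff, star_ry, ry_mul_ry, add_neg_cancel, ry_zero]

lemma pauliX_mul_ry_mul_pauliX (a : ℝ) : pauliX * ry a * pauliX = ry (-a) := by
  ext i j; fin_cases i <;> fin_cases j <;>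
    simp [ry, pauliX, Matrix.mul_apply, Fin.sum_univ_two]

/-! ### Unitarity of circuits -/

lemma cnot_op_eq_mux (V : QubitOp R) (c t : Q) (h : c ≠ t) :
    (CircuitStep.cnot c t h : CircuitStep Q R).op V =
      mux t fun y => if y c = 1 then pauliX else 1 := by
  ext x y
  simp only [CircuitStep.op, Matrix.of_apply]
  by_cases hxy : ∀ r, r ≠ t → x r = y r
  · have hiff : x = Function.update y t (y t + y c) ↔ x t = y t + y c := by
      conv_lhs => rw [← eq_update_of_agree hxy]
      exact (Function.update_injective y t).eq_iff
    rw [mux_apply_of_agree _ hxy]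
    simp only [hiff]
    generalize x t = a, y t = b, y c = d
    fin_cases a <;> fin_cases b <;> fin_cases d <;> simp [pauliX]
  · push Not at hxy
    obtain ⟨r, hr, hne⟩ := hxy
    rw [mux_apply_of_ne _ hr hne, if_neg]
    intro h'
    apply hne
    rw [h', Function.update_of_ne hr]

lemma embedOp_apply_of_agree {w : R ↪ Q} (V : QubitOp R) {x y : Q → Fin 2}
    (h : ∀ q, (∀ i, w i ≠ q) → x q = y q) : embedOp w V x y = V (x ∘ w) (y ∘ w) := by
  simp only [embedOp, Matrix.of_apply, if_pos h]

lemma embedOp_apply_of_ne {w : R ↪ Q} (V : QubitOp R) {x y : Q → Fin 2} {q : Q}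
    (hq : ∀ i, w i ≠ q) (h : x q ≠ y q) : embedOp w V x y = 0 := by
  simp only [embedOp, Matrix.of_apply]
  exact if_neg fun h' => h (h' q hq)

/-- The intermediate states that contribute agree with `y` off the range of `w`: they are the
extensions of `y` by arbitrary values on that range. -/
lemma embedOp_mul (w : R ↪ Q) (V V' : QubitOp R) [DecidableEq R] :
    embedOp w V * embedOp w V' = embedOp w (V * V') := by
  classical
  ext x y
  by_cases h : ∀ q, (∀ i, w i ≠ q) → x q = y q
  · rw [embedOp_apply_of_agree _ h, Matrix.mul_apply, Matrix.mul_apply]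
    have key : ∀ v : R → Fin 2, Function.extend w v y ∘ w = v := fun v => by
      funext i; simp [w.injective.extend_apply]
    refine (Fintype.sum_of_injective (fun v : R → Fin 2 => Function.extend w v y) ?_ _ _ ?_ ?_).symm
    · intro v v' hv
      rw [← key v, ← key v']
      exact congrArg (· ∘ w) hv
    · intro z hz
      rw [mul_eq_zero]; right
      simp only [embedOp, Matrix.of_apply]
      refine if_neg fun hzy => hz ⟨z ∘ w, ?_⟩
      funext q
      by_cases hq : ∃ i, w i = q
      · obtain ⟨i, rfl⟩ := hq
        simp [w.injective.extend_apply]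
      · change Function.extend w (z ∘ w) y q = z q
        rw [Function.extend_apply' _ _ _ hq, hzy q (by push Not at hq; exact hq)]
    · intro v
      have hv : ∀ q, (∀ i, w i ≠ q) → Function.extend w v y q = y q := fun q hq =>
        Function.extend_apply' _ _ _ (by push Not; exact hq)
      rw [embedOp_apply_of_agree, embedOp_apply_of_agree _ hv, key]
      intro q hq
      rw [hv q hq, h q hq]
  · push Not at h
    obtain ⟨q, hq, hxy⟩ := h
    rw [embedOp_apply_of_ne _ hq hxy, Matrix.mul_apply]
    refine Finset.sum_eq_zero fun z _ => ?_
    by_cases hz : x q = z q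
    · rw [embedOp_apply_of_ne V' hq (fun h => hxy (hz.trans h)), mul_zero]
    · rw [embedOp_apply_of_ne V hq hz, zero_mul]

lemma embedOp_one (w : R ↪ Q) [DecidableEq R] : embedOp w (1 : QubitOp R) = 1 := by
  ext x y
  by_cases h : ∀ q, (∀ i, w i ≠ q) → x q = y q
  · rw [embedOp_apply_of_agree _ h, Matrix.one_apply, Matrix.one_apply]
    congr 1
    rw [eq_iff_iff]
    refine ⟨fun hw => ?_, fun hxy => by rw [hxy]⟩
    funext q
    by_cases hq : ∃ i, w i = q
    · obtain ⟨i, rfl⟩ := hq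
      exact congrFun hw i
    · exact h q (by push Not at hq; exact hq)
  · push Not at h
    obtain ⟨q, hq, hxy⟩ := h
    rw [embedOp_apply_of_ne _ hq hxy, Matrix.one_apply_ne]
    exact fun h' => hxy (by rw [h'])

lemma star_embedOp (w : R ↪ Q) (V : QubitOp R) : star (embedOp w V) = embedOp w (star V) := by
  ext x y
  rw [Matrix.star_apply]
  by_cases h : ∀ q, (∀ i, w i ≠ q) → x q = y q
  · rw [embedOp_apply_of_agree _ h, embedOp_apply_of_agree _ fun q hq => (h q hq).symm,
      Matrix.star_apply]
  · push Not at h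
    obtain ⟨q, hq, hxy⟩ := h
    rw [embedOp_apply_of_ne _ hq hxy, embedOp_apply_of_ne _ hq hxy.symm, star_zero]

/-- The query preserves its control qubit, so columns with different control values are orthogonal.
Columns with the same value are columns of `embedOp w V` or of the identity. -/
lemma query_op_mem (c : Q) (w : R ↪ Q) (h : ∀ i, w i ≠ c) [DecidableEq R] {V : QubitOp R}
    (hV : V ∈ Matrix.unitaryGroup (R → Fin 2) ℂ) :
    (CircuitStep.query c w h : CircuitStep Q R).op V ∈ Matrix.unitaryGroup (Q → Fin 2) ℂ := by
  rw [Matrix.mem_unitaryGroup_iff']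
  ext x y
  rw [Matrix.mul_apply]
  simp only [CircuitStep.op, Matrix.star_apply, Matrix.of_apply]
  have hE : star (embedOp w V) * embedOp w V = 1 := by
    rw [star_embedOp, embedOp_mul, Matrix.mem_unitaryGroup_iff'.1 hV, embedOp_one]
  have hE' := congrFun (congrFun hE x) y
  rw [Matrix.mul_apply] at hE'
  by_cases hx : x c = 1 <;> by_cases hy : y c = 1 <;> simp only [hx, hy, if_true, if_false]
  · exact hE'
  · rw [Matrix.one_apply_ne (fun h => hy (by rw [← h]; exact hx))]
    refine Finset.sum_eq_zero fun z _ => ?_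
    by_cases hz : z = y
    · subst hz
      rw [embedOp_apply_of_ne V h (by rw [hx]; exact hy), star_zero, zero_mul]
    · rw [Matrix.one_apply_ne hz, mul_zero]
  · rw [Matrix.one_apply_ne (fun h => hx (by rw [h]; exact hy))]
    refine Finset.sum_eq_zero fun z _ => ?_
    by_cases hz : z = x
    · subst hz
      rw [embedOp_apply_of_ne V h (by rw [hy]; exact hx), mul_zero]
    · rw [Matrix.one_apply_ne hz, star_zero, zero_mul]
  · simp [Matrix.one_apply, eq_comm]

lemma circuitOp_mem [DecidableEq R] {V : QubitOp R}
    (hV : V ∈ Matrix.unitaryGroup (R → Fin 2) ℂ) (gs : List (CircuitStep Q R)) :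
    circuitOp V gs ∈ Matrix.unitaryGroup (Q → Fin 2) ℂ := by
  induction gs with
  | nil => exact one_mem _
  | cons g gs ih =>
    refine mul_mem ih ?_
    cases g with
    | single u q => exact mux_mem_unitaryGroup (fun _ _ => rfl) fun _ => u.2
    | cnot c t h =>
      rw [cnot_op_eq_mux]
      refine mux_mem_unitaryGroup (fun y b => ?_) fun y => ?_
      · rw [Function.update_of_ne h]
      · split_ifs
        · exact pauliX_mem
        · exact one_mem _
    | query c w h => exact query_op_mem c w h hV

lemma circuitOp_append (V : QubitOp R) (gs gs' : List (CircuitStep Q R)) :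
    circuitOp V (gs ++ gs') = circuitOp V gs' * circuitOp V gs := by
  induction gs with
  | nil => simp [circuitOp]
  | cons g gs ih => simp [circuitOp, ih, Matrix.mul_assoc]

end Gates

/-! ### Synthesis of multiply controlled gates -/

section Synthesis

variable {Q R : Type} [Fintype Q] [DecidableEq Q] [Fintype R]

lemma queryCount_append (gs gs' : List (CircuitStep Q R)) :
    queryCount (gs ++ gs') = queryCount gs + queryCount gs' := List.countP_append

lemma gateCount_append (gs gs' : List (CircuitStep Q R)) :
    gateCount (gs ++ gs') = gateCount gs + gateCount gs' := List.countP_append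

lemma queryCount_cons_query (c : Q) (w : R ↪ Q) (h : ∀ i, w i ≠ c)
    (gs : List (CircuitStep Q R)) : queryCount (.query c w h :: gs) = queryCount gs + 1 :=
  List.countP_cons_of_pos rfl

lemma gateCount_cons_query (c : Q) (w : R ↪ Q) (h : ∀ i, w i ≠ c)
    (gs : List (CircuitStep Q R)) : gateCount (.query c w h :: gs) = gateCount gs :=
  List.countP_cons_of_neg (by simp [CircuitStep.isQuery])

variable (R) in
/-- `M` is the operator of a circuit without queries that has at most `g` gates. -/
def Synth (M : QubitOp Q) (g : ℕ) : Prop :=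
  ∃ circ : List (CircuitStep Q R), queryCount circ = 0 ∧ gateCount circ ≤ g ∧
    ∀ V, circuitOp V circ = M

lemma Synth.mono {M : QubitOp Q} {g g' : ℕ} (h : Synth R M g) (hg : g ≤ g') : Synth R M g' := by
  obtain ⟨circ, h1, h2, h3⟩ := h
  exact ⟨circ, h1, h2.trans hg, h3⟩

lemma Synth.mul {M N : QubitOp Q} {g g' : ℕ} (hM : Synth R M g) (hN : Synth R N g') :
    Synth R (M * N) (g + g') := by
  obtain ⟨c, h1, h2, h3⟩ := hM
  obtain ⟨c', h1', h2', h3'⟩ := hN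
  refine ⟨c' ++ c, ?_, ?_, fun V => ?_⟩
  · rw [queryCount_append, h1, h1']
  · rw [gateCount_append]
    omega
  · rw [circuitOp_append, h3, h3']

lemma synth_one : Synth R (1 : QubitOp Q) 0 :=
  ⟨[], rfl, le_rfl, fun _ => rfl⟩

lemma synth_single (q : Q) {u : Matrix (Fin 2) (Fin 2) ℂ}
    (hu : u ∈ Matrix.unitaryGroup (Fin 2) ℂ) : Synth R (mux q fun _ => u) 1 := by
  refine ⟨[.single ⟨u, hu⟩ q], rfl, le_rfl, fun V => ?_⟩
  simp only [circuitOp, one_mul]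
  rfl

lemma synth_cnot {c t : Q} (h : c ≠ t) :
    Synth R (mux t fun y => if y c = 1 then pauliX else 1) 1 := by
  refine ⟨[.cnot c t h], rfl, le_rfl, fun V => ?_⟩
  simp only [circuitOp, one_mul]
  exact cnot_op_eq_mux V c t h

/-- The basis state `y` has the prescribed values at the qubits of the list `S`. -/
def Matches (S : List (Q × Fin 2)) (y : Q → Fin 2) : Prop := ∀ c ∈ S, y c.1 = c.2

instance (S : List (Q × Fin 2)) : DecidablePred (Matches S) := fun _ =>
  inferInstanceAs (Decidable (∀ c ∈ S, _))

/-- The multiplexed gate `u`, controlled by the pattern `S`. -/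
def ctrl (S : List (Q × Fin 2)) (u : Matrix (Fin 2) (Fin 2) ℂ) (y : Q → Fin 2) :
    Matrix (Fin 2) (Fin 2) ℂ :=
  if Matches S y then u else 1

lemma matches_append (S S' : List (Q × Fin 2)) (y : Q → Fin 2) :
    Matches (S ++ S') y ↔ Matches S y ∧ Matches S' y := by
  simp only [Matches, List.mem_append, or_imp, forall_and]

lemma matches_cons (c : Q × Fin 2) (S : List (Q × Fin 2)) (y : Q → Fin 2) :
    Matches (c :: S) y ↔ y c.1 = c.2 ∧ Matches S y := by
  simp only [Matches, List.forall_mem_cons]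

lemma matches_congr {S : List (Q × Fin 2)} {y z : Q → Fin 2} (h : ∀ c ∈ S.map Prod.fst, y c = z c) :
    Matches S y ↔ Matches S z := by
  refine forall₂_congr fun c hc => ?_
  rw [h c.1 (List.mem_map_of_mem hc)]

lemma matches_update {S : List (Q × Fin 2)} {q : Q} (hq : q ∉ S.map Prod.fst) (y : Q → Fin 2)
    (b : Fin 2) : Matches S (Function.update y q b) ↔ Matches S y :=
  matches_congr fun c hc => Function.update_of_ne (fun h => hq (by rw [← h]; exact hc)) _ _

lemma indep_ctrl {S : List (Q × Fin 2)} {q : Q} (hq : q ∉ S.map Prod.fst)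
    (u : Matrix (Fin 2) (Fin 2) ℂ) : Indep q (ctrl S u) := fun y b => by
  simp only [ctrl, matches_update hq]

lemma Synth.mux_mul {q : Q} {u v : (Q → Fin 2) → Matrix (Fin 2) (Fin 2) ℂ} {a b : ℕ}
    (hu : Synth R (mux q u) a) (hv : Synth R (mux q v) b) (hi : Indep q u) :
    Synth R (mux q fun y => u y * v y) (a + b) := by
  rw [← mux_mul_mux hi]
  exact hu.mul hv

lemma Synth.congr_mux {q : Q} {u v : (Q → Fin 2) → Matrix (Fin 2) (Fin 2) ℂ} {g : ℕ}
    (hu : Synth R (mux q u) g) (h : ∀ y, u y = v y) : Synth R (mux q v) g := by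
  rwa [← funext h]

/-! ### Multiply controlled `X`: commutators, first up to a phase, then exactly. -/

variable (R) in
/-- Both `ω X` and its inverse, controlled by `S` and applied to `q`, can be synthesized for some
phase `ω`. -/
def SynthPhaseX (S : List (Q × Fin 2)) (q : Q) (g : ℕ) : Prop :=
  ∃ ω : ℂ, ω * star ω = 1 ∧ Synth R (mux q (ctrl S (ω • pauliX))) g ∧
    Synth R (mux q (ctrl S (star ω • pauliX))) g

lemma SynthPhaseX.mono {S : List (Q × Fin 2)} {q : Q} {g g' : ℕ} (h : SynthPhaseX R S q g)
    (hg : g ≤ g') : SynthPhaseX R S q g' := by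
  obtain ⟨ω, h1, h2, h3⟩ := h
  exact ⟨ω, h1, h2.mono hg, h3.mono hg⟩

lemma indep_const {β : Type*} (q : Q) (u : β) : Indep q fun _ : Q → Fin 2 => u := fun _ _ => rfl

lemma Indep.mul {q : Q} {u v : (Q → Fin 2) → Matrix (Fin 2) (Fin 2) ℂ} (hu : Indep q u)
    (hv : Indep q v) : Indep q fun y => u y * v y := fun y b => by
  simp only [hu y b, hv y b]

/-- The matrix `diag(1, w)`. -/
def phaseGate (w : ℂ) : Matrix (Fin 2) (Fin 2) ℂ := !![1, 0; 0, w]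

lemma star_phaseGate (w : ℂ) : star (phaseGate w) = phaseGate (star w) := by
  ext i j; fin_cases i <;> fin_cases j <;> simp [phaseGate]

lemma phaseGate_mul (w w' : ℂ) : phaseGate w * phaseGate w' = phaseGate (w * w') := by
  ext i j; fin_cases i <;> fin_cases j <;>
    simp [phaseGate, Matrix.mul_apply, Fin.sum_univ_two]

lemma phaseGate_one : phaseGate 1 = 1 := by simp [phaseGate, Matrix.one_fin_two]

lemma phaseGate_mem {w : ℂ} (hw : w * star w = 1) :
    phaseGate w ∈ Matrix.unitaryGroup (Fin 2) ℂ := by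
  rw [Matrix.mem_unitaryGroup_iff, star_phaseGate, phaseGate_mul, hw, phaseGate_one]

lemma star_mul_star_star {w : ℂ} (hw : w * star w = 1) : star w * star (star w) = 1 := by
  rw [star_star, mul_comm, hw]

/-- The commutator of two controlled reflections is a rotation controlled by both patterns. -/
lemma synth_ctrl_commutator {S S' : List (Q × Fin 2)} {q : Q} {a b : ℕ} (hS : q ∉ S.map Prod.fst)
    (hS' : q ∉ S'.map Prod.fst) (h : SynthPhaseX R S q a) (h' : SynthPhaseX R S' q b) {w : ℂ}
    (hw : w * star w = 1) :
    Synth R (mux q (ctrl (S ++ S') !![w ^ 2, 0; 0, star w ^ 2])) (2 * a + 2 * b + 4) := by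
  obtain ⟨ω, h1, h2, h3⟩ := h
  obtain ⟨η, h1', h2', h3'⟩ := h'
  -- Conjugation by `phaseGate w` changes the axis of the second reflection. It needs no control,
  -- since it cancels wherever the pattern fails.
  have hc : ∀ (v : (Q → Fin 2) → Matrix (Fin 2) (Fin 2) ℂ), Indep q v →
      Synth R (mux q v) b →
      Synth R (mux q fun y => phaseGate w * v y * phaseGate (star w)) (1 + b + 1) :=
    fun v hv hs => ((synth_single q (phaseGate_mem hw)).mux_mul hs (indep_const _ _)).mux_mul
      (synth_single q (phaseGate_mem (star_mul_star_star hw))) ((indep_const _ _).mul hv)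
  have i1 := indep_ctrl hS (ω • pauliX)
  have i2 : Indep q fun y => phaseGate w * ctrl S' (η • pauliX) y * phaseGate (star w) :=
    ((indep_const _ _).mul (indep_ctrl hS' _)).mul (indep_const _ _)
  have i3 := indep_ctrl hS (star ω • pauliX)
  have key := ((h2.mux_mul (hc _ (indep_ctrl hS' _) h2') i1).mux_mul h3 (i1.mul i2)).mux_mul
    (hc _ (indep_ctrl hS' _) h3') ((i1.mul i2).mul i3)
  refine (key.congr_mux fun y => ?_).mono (by omega)
  have hw' : star w * w = 1 := by rw [mul_comm, hw]
  have hφ : phaseGate w * phaseGate (star w) = 1 := by rw [phaseGate_mul, hw, phaseGate_one]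
  have hφ' : phaseGate (star w) * phaseGate w = 1 := by rw [phaseGate_mul, hw', phaseGate_one]
  -- If only one pattern holds, the word collapses to a gate times its inverse. If both hold, `ω`
  -- and `η` meet their conjugates and the square of `diag(w, star w)` remains.
  by_cases hm : Matches S y <;> by_cases hm' : Matches S' y <;>
    simp only [ctrl, matches_append, hm, hm', and_true, and_false, if_true, if_false, mul_one,
      one_mul, hφ]
  · have e : ∀ x : ℂ, pauliX * (phaseGate w * (x • pauliX) * phaseGate (star w)) =
        x • !![w, 0; 0, star w] := fun x => by
      ext i j; fin_cases i <;> fin_cases j <;>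
        simp [phaseGate, pauliX, Matrix.mul_apply, Fin.sum_univ_two, mul_comm]
    rw [Matrix.mul_assoc (ω • pauliX * _), Matrix.smul_mul, Matrix.smul_mul, Matrix.smul_mul, e, e]
    simp only [Matrix.smul_mul, Matrix.mul_smul, smul_smul]
    have : ω * (star ω * (η * star η)) = 1 := by rw [h1', mul_one, h1]
    rw [show ω * (star ω * star η * η) = 1 by rw [← this]; ring, one_smul]
    ext i j; fin_cases i <;> fin_cases j <;>
      simp [Matrix.mul_apply, Fin.sum_univ_two, pow_two]
  · rw [Matrix.smul_mul, Matrix.mul_smul, smul_smul, h1, pauliX_mul_self, one_smul]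
  · have e : ∀ x : ℂ, phaseGate w * (x • pauliX) * phaseGate (star w) =
        x • (phaseGate w * pauliX * phaseGate (star w)) := fun x => by
      rw [Matrix.mul_smul, Matrix.smul_mul]
    rw [e, e, Matrix.smul_mul, Matrix.mul_smul, smul_smul, h1', one_smul]
    calc phaseGate w * pauliX * phaseGate (star w) * (phaseGate w * pauliX * phaseGate (star w))
        = phaseGate w * (pauliX * ((phaseGate (star w) * phaseGate w) * pauliX)) *
            phaseGate (star w) := by simp only [Matrix.mul_assoc]
      _ = 1 := by rw [hφ', one_mul, pauliX_mul_self, mul_one, hφ]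

lemma hadamard_conj_phase :
    hadamard * !![Complex.I, 0; 0, -Complex.I] * hadamard = Complex.I • pauliX := by
  have := inv_sqrt_two_mul_self
  have e : ∀ x : ℂ, (√2 : ℂ)⁻¹ * x * (√2 : ℂ)⁻¹ = x / 2 := fun x => by
    rw [mul_right_comm, this]; ring
  ext i j; fin_cases i <;> fin_cases j <;>
    simp [hadamard, pauliX, Matrix.mul_apply, Fin.sum_univ_two, e]

lemma hadamard_conj_pauliZ : hadamard * !![1, 0; 0, -1] * hadamard = pauliX := by
  have := inv_sqrt_two_mul_self
  ext i j; fin_cases i <;> fin_cases j <;>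
    simp [hadamard, pauliX, Matrix.mul_apply, Fin.sum_univ_two, this] <;> norm_num

lemma Synth.conj_hadamard {S : List (Q × Fin 2)} {q : Q} {u : Matrix (Fin 2) (Fin 2) ℂ} {g : ℕ}
    (h : Synth R (mux q (ctrl S u)) g) (hS : q ∉ S.map Prod.fst) :
    Synth R (mux q (ctrl S (hadamard * u * hadamard))) (g + 2) := by
  have := ((synth_single (R := R) q hadamard_mem).mux_mul h (indep_const _ _)).mux_mul
    (synth_single q hadamard_mem) ((indep_const _ _).mul (indep_ctrl hS _))
  refine (this.congr_mux fun y => ?_).mono (by omega)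
  by_cases hm : Matches S y <;> simp [ctrl, hm, hadamard_mul_self]

lemma exists_sq_eq_I : ∃ w : ℂ, w * star w = 1 ∧ w ^ 2 = Complex.I ∧ star w ^ 2 = -Complex.I := by
  have h2 := inv_sqrt_two_mul_self
  refine ⟨(√2 : ℂ)⁻¹ * (1 + Complex.I), ?_, ?_, ?_⟩
  · have : star ((√2 : ℂ)⁻¹ * (1 + Complex.I)) = (√2 : ℂ)⁻¹ * (1 - Complex.I) := by
      simp [sub_eq_add_neg]
    rw [this]
    linear_combination (1 - Complex.I ^ 2) * h2 - (1 / 2 : ℂ) * Complex.I_sq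
  · linear_combination (1 + Complex.I) ^ 2 * h2 + (1 / 2 : ℂ) * Complex.I_sq
  · have : star ((√2 : ℂ)⁻¹ * (1 + Complex.I)) = (√2 : ℂ)⁻¹ * (1 - Complex.I) := by
      simp [sub_eq_add_neg]
    rw [this]
    linear_combination (1 - Complex.I) ^ 2 * h2 + (1 / 2 : ℂ) * Complex.I_sq

/-- For `w ^ 2 = i` the commutator is `diag(i, -i)`, which Hadamard gates turn into `iX`; the
conjugate of `w` yields the inverse. The phases of the two given gates are lost in the commutator,
so knowing them only up to a phase is enough to iterate. -/
lemma SynthPhaseX.append {S S' : List (Q × Fin 2)} {q : Q} {a b : ℕ} (hS : q ∉ S.map Prod.fst)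
    (hS' : q ∉ S'.map Prod.fst) (h : SynthPhaseX R S q a) (h' : SynthPhaseX R S' q b) :
    SynthPhaseX R (S ++ S') q (2 * a + 2 * b + 6) := by
  obtain ⟨w, hw, hI, hI'⟩ := exists_sq_eq_I
  have hq : q ∉ (S ++ S').map Prod.fst := by
    rw [List.map_append, List.mem_append]; tauto
  refine ⟨Complex.I, by simp, ?_, ?_⟩
  · have := (synth_ctrl_commutator hS hS' h h' hw).conj_hadamard hq
    rwa [hI, hI', hadamard_conj_phase] at this
  · have := (synth_ctrl_commutator hS hS' h h' (star_mul_star_star hw)).conj_hadamard hq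
    rw [star_star, hI, hI'] at this
    have e : (!![-Complex.I, 0; 0, Complex.I] : Matrix (Fin 2) (Fin 2) ℂ) =
        -!![Complex.I, 0; 0, -Complex.I] := by simp
    rw [e, Matrix.mul_neg, Matrix.neg_mul, hadamard_conj_phase, ← neg_smul] at this
    simpa using this

lemma synthPhaseX_nil (q : Q) : SynthPhaseX R [] q 1 := by
  have : Synth R (mux q (ctrl [] pauliX)) 1 :=
    (synth_single q pauliX_mem).congr_mux fun y => by simp [ctrl, Matches]
  exact ⟨1, by simp, by simpa using this, by simpa using this⟩

lemma synthPhaseX_singleton {c q : Q} (h : c ≠ q) (b : Fin 2) : SynthPhaseX R [(c, b)] q 2 := by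
  have : Synth R (mux q (ctrl [(c, b)] pauliX)) 2 := by
    match b with
    | 1 =>
      refine ((synth_cnot h).mono one_le_two).congr_mux fun y => ?_
      simp [ctrl, Matches]
    | 0 =>
      refine ((synth_single q pauliX_mem).mux_mul (synth_cnot h) (indep_const _ _)).congr_mux
        fun y => ?_
      have : y c = 0 ∨ y c = 1 := by omega
      rcases this with hy | hy <;> simp [ctrl, Matches, hy, pauliX_mul_self]
  exact ⟨1, by simp, by simpa using this, by simpa using this⟩

/-- Halving the pattern multiplies the cost by about four, hence the quadratic growth. The slack `4`
absorbs the constant `6` of `SynthPhaseX.append`; for odd `n` the induction step is then an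
equality. -/
lemma exists_synthPhaseX (n : ℕ) : ∀ (S : List (Q × Fin 2)) (q : Q), S.length = n → 1 ≤ n →
    q ∉ S.map Prod.fst → ∃ g, g + 4 ≤ 6 * n ^ 2 ∧ SynthPhaseX R S q g := by
  induction n using Nat.strong_induction_on with
  | _ n ih =>
    intro S q hn h1 hq
    rcases h1.eq_or_lt with h1 | h1
    · subst h1
      obtain ⟨⟨c, b⟩, rfl⟩ := List.length_eq_one_iff.1 hn
      exact ⟨2, by norm_num, synthPhaseX_singleton (fun h => hq (by simp [h])) b⟩
    · have hS := List.take_append_drop (n / 2) S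
      have hq1 : q ∉ (S.take (n / 2)).map Prod.fst := fun h => hq (by
        rw [← hS, List.map_append, List.mem_append]; exact Or.inl h)
      have hq2 : q ∉ (S.drop (n / 2)).map Prod.fst := fun h => hq (by
        rw [← hS, List.map_append, List.mem_append]; exact Or.inr h)
      obtain ⟨a, ha, hsa⟩ := ih (n / 2) (by omega) (S.take (n / 2)) q
        (by rw [List.length_take]; omega) (by omega) hq1
      obtain ⟨b, hb, hsb⟩ := ih (n - n / 2) (by omega) (S.drop (n / 2)) q
        (by rw [List.length_drop]; omega) (by omega) hq2
      refine ⟨2 * a + 2 * b + 6, ?_, hS ▸ hsa.append hq1 hq2 hsb⟩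
      obtain ⟨k, hk | hk⟩ := Nat.even_or_odd' n
      · have e1 : n / 2 = k := by omega
        have e2 : n - n / 2 = k := by omega
        rw [e2] at hb; rw [e1] at ha; rw [hk]
        nlinarith
      · have e1 : n / 2 = k := by omega
        have e2 : n - n / 2 = k + 1 := by omega
        rw [e2] at hb; rw [e1] at ha; rw [hk]
        nlinarith

lemma synthPhaseX (S : List (Q × Fin 2)) (q : Q) (hq : q ∉ S.map Prod.fst) :
    SynthPhaseX R S q (6 * S.length ^ 2 + 1) := by
  rcases Nat.eq_zero_or_pos S.length with h | h
  · rw [List.length_eq_zero_iff] at h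
    subst h
    exact synthPhaseX_nil q
  · obtain ⟨g, hg, hs⟩ := exists_synthPhaseX (R := R) S.length S q rfl h hq
    exact hs.mono (by omega)

/-- A diagonal gate has no distinguished target, so a sign can be moved from one target to another.
-/
lemma mux_diagonal (q : Q) (D : (Q → Fin 2) → Fin 2 → ℂ) :
    mux q (fun y => Matrix.diagonal (D y)) = Matrix.diagonal fun y => D y (y q) := by
  ext x y
  by_cases hxy : x = y
  · subst hxy
    rw [mux_apply_of_agree _ fun _ _ => rfl, Matrix.diagonal_apply_eq, Matrix.diagonal_apply_eq]
  · rw [Matrix.diagonal_apply_ne _ hxy]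
    by_cases h : ∀ r, r ≠ q → x r = y r
    · rw [mux_apply_of_agree _ h, Matrix.diagonal_apply_ne]
      intro hq
      exact hxy (by rw [← eq_update_of_agree h, hq, Function.update_eq_self])
    · push Not at h
      obtain ⟨r, hr, hne⟩ := h
      exact mux_apply_of_ne _ hr hne

/-- A phase flip on the pattern `(t, 1) :: S`, which may be applied at any other qubit `d`. -/
lemma mux_phaseFlip_eq (S : List (Q × Fin 2)) (d t : Q) :
    mux d (ctrl ((t, 1) :: S) (-1)) = mux t (ctrl S !![1, 0; 0, -1]) := by
  have e1 : ctrl ((t, 1) :: S) (-1) = fun y : Q → Fin 2 => Matrix.diagonal fun _ =>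
      if y t = 1 ∧ Matches S y then (-1 : ℂ) else 1 := by
    funext y
    by_cases h : y t = 1 ∧ Matches S y
    · simp only [ctrl, matches_cons, h, and_self, if_true]
      ext i j; fin_cases i <;> fin_cases j <;> simp
    · simp only [ctrl, matches_cons, h, if_false]
      exact Matrix.diagonal_one.symm
  have e2 : ctrl S !![1, 0; 0, -1] = fun y : Q → Fin 2 => Matrix.diagonal fun b =>
      if b = 1 ∧ Matches S y then (-1 : ℂ) else 1 := by
    funext y
    by_cases h : Matches S y
    · simp only [ctrl, h, if_true]
      ext i j; fin_cases i <;> fin_cases j <;> simp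
    · simp only [ctrl, h, if_false, and_false]
      exact Matrix.diagonal_one.symm
  rw [e1, e2, mux_diagonal, mux_diagonal]

/-- The multiply controlled `X` gate has a circuit of quadratic size, if some further qubit is at
hand. -/
lemma synth_ctrl_pauliX {S : List (Q × Fin 2)} {t d : Q} (ht : t ∉ S.map Prod.fst)
    (hd : d ∉ S.map Prod.fst) (hdt : d ≠ t) :
    Synth R (mux t (ctrl S pauliX)) (12 * (S.length + 1) ^ 2 + 10) := by
  have hd' : d ∉ ((t, 1) :: S).map Prod.fst := by
    rw [List.map_cons, List.mem_cons]; tauto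
  -- With `w = i` and an empty first pattern the commutator is `-1`, a pure sign on the second
  -- pattern, free of unknown phases. Its target `d` is merely borrowed: it may be in any state and
  -- is left unchanged.
  have h := synth_ctrl_commutator (R := R) (by simp) hd' (synthPhaseX_nil d)
    (synthPhaseX _ d hd') (w := Complex.I) (by simp)
  have e : (!![Complex.I ^ 2, 0; 0, star Complex.I ^ 2] : Matrix (Fin 2) (Fin 2) ℂ) = -1 := by
    ext i j; fin_cases i <;> fin_cases j <;> simp
  rw [e, List.nil_append, mux_phaseFlip_eq] at h
  have h' := h.conj_hadamard ht
  rw [hadamard_conj_pauliZ] at h'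
  refine h'.mono (le_of_eq ?_)
  rw [List.length_cons]; ring

/-! ### Multiplexed rotations -/

variable (R) in
/-- All rotations of `q` by an angle that depends on `feat` can be synthesized with `g` gates. -/
def SynthRy {β : Type*} (q : Q) (feat : (Q → Fin 2) → β) (g : ℕ) : Prop :=
  ∀ φ : β → ℝ, Synth R (mux q fun y => ry (φ (feat y))) g

/-- Conjugation by `X` reverses a rotation, so two `X` gates controlled by `P` around one rotation
switch its sign according to `P`. -/
lemma SynthRy.prod_decide {β : Type*} {q : Q} {feat : (Q → Fin 2) → β} {g κ : ℕ}
    (h : SynthRy R q feat g) (hf : Indep q feat) {P : (Q → Fin 2) → Prop} [DecidablePred P]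
    (hP : Indep q P) (hκ : Synth R (mux q fun y => if P y then pauliX else 1) κ) :
    SynthRy R q (fun y => (decide (P y), feat y)) (2 * g + 2 * κ) := by
  intro φ
  have iP : Indep q fun y => if P y then pauliX else 1 := fun y b => by
    simp only [hP y b]
  have iry : ∀ ψ : β → ℝ, Indep q fun y => ry (ψ (feat y)) := fun ψ y b => by
    simp only [hf y b]
  -- Half the difference and half the sum of the two angles: `a + δ` is the angle where `P` fails,
  -- `a - δ` the one where it holds.
  let δ : β → ℝ := fun x => (φ (false, x) - φ (true, x)) / 2
  let a : β → ℝ := fun x => (φ (false, x) + φ (true, x)) / 2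
  have := ((hκ.mux_mul (h δ) iP).mux_mul hκ (iP.mul (iry δ))).mux_mul (h a)
    ((iP.mul (iry δ)).mul iP)
  refine (this.congr_mux fun y => ?_).mono (by omega)
  by_cases hy : P y
  · simp only [hy, if_true, pauliX_mul_ry_mul_pauliX, ry_mul_ry, decide_true, δ, a]
    congr 1; ring
  · simp only [hy, if_false, one_mul, mul_one, ry_mul_ry, decide_false, δ, a]
    congr 1; ring

lemma SynthRy.comp {β γ : Type*} {q : Q} {feat : (Q → Fin 2) → β} {g : ℕ}
    (h : SynthRy R q feat g) {feat' : (Q → Fin 2) → γ} (ψ : β → γ)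
    (hψ : ∀ y, feat' y = ψ (feat y)) : SynthRy R q feat' g := fun φ =>
  (h (φ ∘ ψ)).congr_mux fun y => by rw [hψ]; rfl

lemma indep_map {l : List Q} {q : Q} (hq : q ∉ l) : Indep q fun y : Q → Fin 2 => l.map y :=
  fun _ _ => List.map_congr_left fun _ hc => Function.update_of_ne (fun h => hq (by rw [← h]; exact hc)) _ _

/-- A rotation that is uniformly controlled by `l` qubits has a circuit with `O(2 ^ l)` gates. -/
lemma synthRy_map {q : Q} (l : List Q) (h : q ∉ l) :
    SynthRy R q (fun y => l.map y) (3 * 2 ^ l.length - 2) := by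
  induction l with
  | nil =>
    intro φ
    simp only [List.map_nil]
    exact (synth_single q (ry_mem _)).mono (by simp)
  | cons c l ih =>
    rw [List.mem_cons, not_or] at h
    have hP : Indep q fun y : Q → Fin 2 => y c = 1 := fun y b => by
      simp only [Function.update_of_ne (Ne.symm h.1)]
    have h1 := (ih h.2).prod_decide (indep_map h.2) hP (synth_cnot (Ne.symm h.1))
    have h2 : SynthRy R q (fun y => (c :: l).map y) (2 * (3 * 2 ^ l.length - 2) + 2 * 1) := by
      refine h1.comp (fun x => (if x.1 = true then 1 else 0) :: x.2) fun y => ?_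
      have : y c = 0 ∨ y c = 1 := by omega
      rcases this with hy | hy <;> simp [hy]
    intro φ
    refine (h2 φ).mono ?_
    have := Nat.one_le_two_pow (n := l.length)
    rw [List.length_cons, pow_succ]
    omega

/-! ### The cyclic shift -/

/-- The operator that permutes the basis states by `π`. -/
def permOp (π : (Q → Fin 2) → (Q → Fin 2)) : QubitOp Q :=
  Matrix.of fun x y => if x = π y then 1 else 0

lemma permOp_mul (π π' : (Q → Fin 2) → (Q → Fin 2)) :
    permOp π * permOp π' = permOp (π ∘ π') := by
  ext x y
  rw [Matrix.mul_apply, Finset.sum_eq_single (π' y)]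
  · simp [permOp]
  · intro z _ hz
    simp [permOp, hz]
  · simp

lemma mux_ctrl_pauliX_eq_permOp (S : List (Q × Fin 2)) (t : Q) :
    mux t (ctrl S pauliX) =
      permOp fun y => if Matches S y then Function.update y t (y t + 1) else y := by
  ext x y
  simp only [permOp, Matrix.of_apply]
  have hS : (if Matches S y then Function.update y t (y t + 1) else y) =
      Function.update y t (if Matches S y then y t + 1 else y t) := by
    split_ifs <;> simp
  by_cases hxy : ∀ r, r ≠ t → x r = y r
  · have hiff : x = (if Matches S y then Function.update y t (y t + 1) else y) ↔
        x t = if Matches S y then y t + 1 else y t := by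
      rw [hS]
      conv_lhs => rw [← eq_update_of_agree hxy]
      exact (Function.update_injective y t).eq_iff
    rw [mux_apply_of_agree _ hxy]
    simp only [hiff, ctrl]
    generalize x t = a, y t = b
    by_cases hm : Matches S y <;> simp only [hm, if_true, if_false] <;>
      fin_cases a <;> fin_cases b <;> simp [pauliX]
  · push Not at hxy
    obtain ⟨r, hr, hne⟩ := hxy
    rw [mux_apply_of_ne _ hr hne, if_neg]
    intro h'
    apply hne
    rw [h', hS, Function.update_of_ne hr]

/-- The number with the binary digits at the qubits `l`, least significant digit first. -/
def bitVal (y : Q → Fin 2) : List Q → ℕ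
  | [] => 0
  | b :: l => (y b).val + 2 * bitVal y l

/-- Add one to the number at the qubits `l`, modulo `2 ^ l.length`. -/
def incr : List Q → (Q → Fin 2) → (Q → Fin 2)
  | [], y => y
  | b :: l, y => Function.update (if y b = 1 then incr l y else y) b (y b + 1)

lemma incr_of_notMem {q : Q} : ∀ {l : List Q}, q ∉ l → ∀ y : Q → Fin 2, incr l y q = y q
  | [], _, _ => rfl
  | b :: l, h, y => by
    rw [List.mem_cons, not_or] at h
    rw [incr, Function.update_of_ne h.1]
    split_ifs
    · exact incr_of_notMem h.2 y
    · rfl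

lemma bitVal_congr {y z : Q → Fin 2} : ∀ {l : List Q}, (∀ q ∈ l, y q = z q) →
    bitVal y l = bitVal z l
  | [], _ => rfl
  | b :: l, h => by
    rw [bitVal, bitVal, h b (by simp), bitVal_congr fun q hq => h q (by simp [hq])]

lemma bitVal_lt (y : Q → Fin 2) : ∀ l : List Q, bitVal y l < 2 ^ l.length
  | [] => by simp [bitVal]
  | b :: l => by
    have := bitVal_lt y l
    rw [bitVal, List.length_cons, pow_succ]
    omega

lemma eq_of_bitVal_eq {y z : Q → Fin 2} : ∀ {l : List Q}, bitVal y l = bitVal z l →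
    ∀ q ∈ l, y q = z q
  | [], _, _, hq => by simp at hq
  | b :: l, h, q, hq => by
    rw [bitVal, bitVal] at h
    rcases List.mem_cons.1 hq with rfl | hq
    · omega
    · exact eq_of_bitVal_eq (by omega) q hq

lemma bitVal_append (y : Q → Fin 2) (l' : List Q) : ∀ l : List Q,
    bitVal y (l ++ l') = bitVal y l + 2 ^ l.length * bitVal y l'
  | [] => by simp [bitVal]
  | b :: l => by
    rw [List.cons_append, bitVal, bitVal, bitVal_append y l' l, List.length_cons, pow_succ]
    ring

lemma bitVal_incr : ∀ {l : List Q}, l.Nodup → ∀ y : Q → Fin 2,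
    bitVal (incr l y) l = (bitVal y l + 1) % 2 ^ l.length
  | [], _, y => by simp [bitVal]
  | b :: l, h, y => by
    rw [List.nodup_cons] at h
    have ih := bitVal_incr h.2 y
    have e : bitVal (incr (b :: l) y) l = bitVal (if y b = 1 then incr l y else y) l :=
      bitVal_congr fun q hq => by
        rw [incr, Function.update_of_ne]
        rintro rfl
        exact h.1 hq
    have hlt := bitVal_lt y l
    rw [bitVal, e, incr, Function.update_self, bitVal, List.length_cons, pow_succ]
    have : y b = 0 ∨ y b = 1 := by omega
    rcases this with hb | hb
    · simp only [hb, zero_ne_one, if_false]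
      rw [Nat.mod_eq_of_lt]
      · simp; omega
      · simp; omega
    · simp only [hb, if_true, ih]
      rw [mul_comm _ 2, show ((1 : Fin 2) : ℕ) + 2 * bitVal y l + 1 = 2 * (bitVal y l + 1) by
        simp; ring, Nat.mul_mod_mul_left]
      simp

lemma incr_injective {l : List Q} (h : l.Nodup) : Function.Injective (incr l) := by
  intro y z hyz
  funext q
  by_cases hq : q ∈ l
  · refine eq_of_bitVal_eq ?_ q hq
    have := congrArg (fun x => bitVal x l) hyz
    simp only [bitVal_incr h] at this
    have h1 := bitVal_lt y l
    have h2 := bitVal_lt z l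
    have := Nat.ModEq.add_right_cancel' 1 this
    rwa [Nat.ModEq, Nat.mod_eq_of_lt h1, Nat.mod_eq_of_lt h2] at this
  · rw [← incr_of_notMem hq y, ← incr_of_notMem hq z, hyz]

/-- The carry depends on the old digit `b`, so the increment of `l`, with `b = 1` as a further
control, is applied before `b` is flipped. Each digit removed adds one control; the total number of
both stays constant and bounds the cost per digit. -/
lemma synth_ctrl_incr {d : Q} : ∀ {l : List Q} {S : List (Q × Fin 2)}, l.Nodup →
    (∀ q ∈ l, q ∉ S.map Prod.fst) → d ∉ l → d ∉ S.map Prod.fst →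
    Synth R (permOp fun y => if Matches S y then incr l y else y)
      (l.length * (12 * (S.length + l.length) ^ 2 + 10))
  | [], S, _, _, _, _ => by
    have : permOp (fun y : Q → Fin 2 => if Matches S y then incr [] y else y) = 1 := by
      ext x y
      simp [permOp, incr, Matrix.one_apply]
    rw [this]
    exact synth_one.mono (Nat.zero_le _)
  | b :: l, S, hl, hS, hd, hdS => by
    rw [List.nodup_cons] at hl
    rw [List.mem_cons, not_or] at hd
    have hbS : b ∉ S.map Prod.fst := hS b (by simp)
    have h1 := synth_ctrl_pauliX (R := R) hbS hdS hd.1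
    have h2 := synth_ctrl_incr (d := d) (l := l) (S := (b, 1) :: S) hl.2
      (fun q hq => by
        rw [List.map_cons, List.mem_cons, not_or]
        exact ⟨fun h : q = b => hl.1 (by rw [← h]; exact hq), hS q (by simp [hq])⟩) hd.2
      (by rw [List.map_cons, List.mem_cons, not_or]; exact ⟨hd.1, hdS⟩)
    rw [mux_ctrl_pauliX_eq_permOp] at h1
    have h3 := h1.mul h2
    rw [permOp_mul] at h3
    have e : ((fun y : Q → Fin 2 => if Matches S y then Function.update y b (y b + 1) else y) ∘
        fun y => if Matches ((b, 1) :: S) y then incr l y else y) =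
        fun y => if Matches S y then incr (b :: l) y else y := by
      funext y
      have hm : Matches S (if y b = 1 ∧ Matches S y then incr l y else y) ↔ Matches S y :=
        matches_congr fun c hc => by
          split_ifs
          · exact incr_of_notMem (fun h => hS c (by simp [h]) hc) y
          · rfl
      have hb : (if y b = 1 ∧ Matches S y then incr l y else y) b = y b := by
        split_ifs
        · exact incr_of_notMem hl.1 y
        · rfl
      simp only [Function.comp, matches_cons, hm, hb]
      by_cases hmy : Matches S y <;> simp [hmy, incr]
    rw [e] at h3
    refine h3.mono ?_
    rw [List.length_cons, List.length_cons]
    have : 12 * (S.length + 1) ^ 2 ≤ 12 * (S.length + 1 + l.length) ^ 2 := 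
      Nat.mul_le_mul_left _ (Nat.pow_le_pow_left (by omega) 2)
    rw [show S.length + (l.length + 1) = S.length + 1 + l.length by ring]
    linarith

end Synthesis

/-! ### The circuit -/

section Assembly

variable {Q R : Type} [Fintype Q] [DecidableEq Q] [Fintype R]

/-- Nonzero entries of `M` join basis states that agree at the qubit `q`. -/
def Preserves (q : Q) (M : QubitOp Q) : Prop := ∀ x y, x q ≠ y q → M x y = 0

lemma Preserves.mul {q : Q} {M N : QubitOp Q} (hM : Preserves q M) (hN : Preserves q N) :
    Preserves q (M * N) := fun x y h => by
  rw [Matrix.mul_apply]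
  refine Finset.sum_eq_zero fun z _ => ?_
  by_cases hz : x q = z q
  · rw [hN z y fun h' => h (hz.trans h'), mul_zero]
  · rw [hM x z hz, zero_mul]

lemma preserves_mux {q r : Q} (h : r ≠ q) (u : (Q → Fin 2) → Matrix (Fin 2) (Fin 2) ℂ) :
    Preserves r (mux q u) := fun _ _ hxy => mux_apply_of_ne u h hxy

lemma preserves_permOp {q : Q} {π : (Q → Fin 2) → (Q → Fin 2)} (h : ∀ y, π y q = y q) :
    Preserves q (permOp π) := fun x y hxy => by
  simp only [permOp, Matrix.of_apply]
  rw [if_neg]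
  rintro rfl
  exact hxy (h y)

lemma preserves_one (q : Q) : Preserves q (1 : QubitOp Q) := fun x y h =>
  Matrix.one_apply_ne fun h' => h (by rw [h'])

lemma preserves_query (V : QubitOp R) (c q : Q) (w : R ↪ Q) (h : ∀ i, w i ≠ c)
    (hq : ∀ i, w i ≠ q) : Preserves q ((CircuitStep.query c w h : CircuitStep Q R).op V) :=
  fun x y hxy => by
    simp only [CircuitStep.op, Matrix.of_apply]
    split_ifs
    · exact embedOp_apply_of_ne V hq hxy
    · exact preserves_one q x y hxy

lemma mul_permOp_apply (M : QubitOp Q) (π : (Q → Fin 2) → (Q → Fin 2)) (x y : Q → Fin 2) :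
    (M * permOp π) x y = M x (π y) := by
  rw [Matrix.mul_apply, Finset.sum_eq_single (π y)]
  · simp [permOp]
  · intro z _ hz
    simp [permOp, hz]
  · simp

lemma permOp_mul_apply {π : (Q → Fin 2) → (Q → Fin 2)} (hπ : Function.Involutive π)
    (M : QubitOp Q) (x y : Q → Fin 2) : (permOp π * M) x y = M (π x) y := by
  rw [Matrix.mul_apply, Finset.sum_eq_single (π x)]
  · simp [permOp, hπ x]
  · intro z _ hz
    have : x ≠ π z := fun h => hz (by rw [h, hπ z])
    simp [permOp, this]
  · simp

/-- Since `M` preserves `q`, the cross terms vanish and the Hadamard gates average over the values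
of `q`. Applied to both selectors, this forms the linear combination of the four operators. -/
lemma hadamard_sandwich_apply {q : Q} {M : QubitOp Q} (hM : Preserves q M) {x y : Q → Fin 2}
    (hx : x q = 0) (hy : y q = 0) :
    (mux q (fun _ => hadamard) * (M * mux q fun _ => hadamard)) x y =
      1 / 2 * (M (Function.update x q 0) (Function.update y q 0) +
        M (Function.update x q 1) (Function.update y q 1)) := by
  have h2 := inv_sqrt_two_mul_self
  rw [mux_mul_apply (indep_const _ _)]
  simp only [mul_mux_apply, Fin.sum_univ_two, hx, hy]
  rw [hM (Function.update x q 0) (Function.update y q 1) (by simp),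
    hM (Function.update x q 1) (Function.update y q 0) (by simp)]
  simp only [hadamard, Matrix.of_apply, Matrix.cons_val', Matrix.cons_val_zero,
    Matrix.cons_val_one, Matrix.cons_val_fin_one]
  linear_combination (M (Function.update x q 0) (Function.update y q 0) +
        M (Function.update x q 1) (Function.update y q 1)) * h2

/-- The gates have distinct targets and are chosen by qubits outside `L` only, so their product is a
tensor product for each choice. The set `L` stays fixed while `l` shrinks in the induction. -/
lemma prod_mux_apply {u : Q → (Q → Fin 2) → Matrix (Fin 2) (Fin 2) ℂ} {L : List Q} :
    ∀ {l : List Q}, l.Nodup → l ⊆ L →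
    (∀ b ∈ l, ∀ x y : Q → Fin 2, (∀ q ∉ L, x q = y q) → u b x = u b y) → ∀ x y : Q → Fin 2,
    (l.map fun b => mux b (u b)).prod x y =
      if ∀ q ∉ l, x q = y q then (l.map fun b => u b y (x b) (y b)).prod else 0
  | [], _, _, _, x, y => by
    simp [Matrix.one_apply, funext_iff]
  | b :: l, hl, hL, hu, x, y => by
    rw [List.nodup_cons] at hl
    have ih := prod_mux_apply (u := u) hl.2 (fun q hq => hL (by simp [hq]))
      fun c hc => hu c (by simp [hc])
    have hb : Indep b (u b) := fun z c => hu b (by simp) _ _ fun q hq =>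
      Function.update_of_ne (fun h => hq (by rw [h]; exact hL (by simp))) _ _
    rw [List.map_cons, List.prod_cons, mux_mul_apply hb, Finset.sum_eq_single (y b)]
    · rw [ih, List.map_cons, List.prod_cons]
      have hiff : (∀ q ∉ l, Function.update x b (y b) q = y q) ↔ ∀ q ∉ b :: l, x q = y q := by
        refine ⟨fun h q hq => ?_, fun h q hq => ?_⟩
        · rw [List.mem_cons, not_or] at hq
          rw [← h q hq.2, Function.update_of_ne hq.1]
        · by_cases hqb : q = b
          · subst hqb; simp
          · rw [Function.update_of_ne hqb]
            exact h q (by rw [List.mem_cons, not_or]; exact ⟨hqb, hq⟩)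
      simp only [hiff]
      split_ifs with h
      · congr 1
        · rw [hu b (by simp) x y fun q hq => h q fun h' => hq (hL h')]
        · refine congrArg List.prod (List.map_congr_left fun c hc => ?_)
          rw [Function.update_of_ne]
          rintro rfl
          exact hl.1 hc
      · rw [mul_zero]
    · intro c _ hc
      rw [ih, if_neg, mul_zero]
      exact fun h => hc (by have := h b hl.1; simpa using this)
    · simp

/-- The roles of the qubits: the selectors `j₀` and `j₁`, the qubit `f` that is rotated, the flag
`g` that controls the query, the three fields (`top`, `high`, and `low₀ :: low`) of the number of a
block, and the qubits `w` of the oracle. -/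
structure Layout (Q R : Type) where
  (j₀ j₁ f g top low₀ : Q)
  (low high : List Q)
  (w : R ↪ Q)
  (nodup : (j₀ :: j₁ :: f :: g :: ((low₀ :: low) ++ (high ++ [top]))).Nodup)
  (disjoint : ∀ q ∈ j₀ :: j₁ :: f :: g :: ((low₀ :: low) ++ (high ++ [top])), ∀ i, w i ≠ q)

namespace Layout

variable (ℓ : Layout Q R)

/-- All qubits of the field `low`. -/
def lows : List Q := ℓ.low₀ :: ℓ.low

/-- The qubits of the number of a block, least significant one first. -/
def blockBits : List Q := ℓ.lows ++ (ℓ.high ++ [ℓ.top])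

lemma nodup' : (ℓ.j₀ :: ℓ.j₁ :: ℓ.f :: ℓ.g :: ℓ.blockBits).Nodup := ℓ.nodup

lemma nodup_blockBits : ℓ.blockBits.Nodup :=
  ((((List.nodup_cons.1 ℓ.nodup').2).of_cons).of_cons).of_cons

lemma nodup_lows : ℓ.lows.Nodup := (List.nodup_append.1 ℓ.nodup_blockBits).1

lemma lows_subset : ℓ.lows ⊆ ℓ.blockBits := List.subset_append_left _ _

lemma high_subset : ℓ.high ⊆ ℓ.blockBits := fun q hq => by simp [blockBits, hq]

lemma top_mem : ℓ.top ∈ ℓ.blockBits := by simp [blockBits]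

lemma top_notMem_lows : ℓ.top ∉ ℓ.lows := fun h =>
  (List.nodup_append.1 ℓ.nodup_blockBits).2.2 _ h ℓ.top (by simp) rfl

lemma notMem_blockBits : ℓ.j₀ ∉ ℓ.blockBits ∧ ℓ.j₁ ∉ ℓ.blockBits ∧ ℓ.f ∉ ℓ.blockBits ∧
    ℓ.g ∉ ℓ.blockBits := by
  have := ℓ.nodup'
  simp only [List.nodup_cons, List.mem_cons, not_or] at this
  tauto

lemma ancilla_ne : ℓ.j₀ ≠ ℓ.j₁ ∧ ℓ.j₀ ≠ ℓ.f ∧ ℓ.j₀ ≠ ℓ.g ∧ ℓ.j₁ ≠ ℓ.f ∧ ℓ.j₁ ≠ ℓ.g ∧ ℓ.f ≠ ℓ.g := by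
  have := ℓ.nodup'
  simp only [List.nodup_cons, List.mem_cons, not_or] at this
  tauto

lemma w_ne : (∀ i, ℓ.w i ≠ ℓ.j₀) ∧ (∀ i, ℓ.w i ≠ ℓ.j₁) ∧ (∀ i, ℓ.w i ≠ ℓ.f) ∧
    (∀ i, ℓ.w i ≠ ℓ.g) ∧ ∀ q ∈ ℓ.blockBits, ∀ i, ℓ.w i ≠ q :=
  ⟨ℓ.disjoint _ (by simp), ℓ.disjoint _ (by simp), ℓ.disjoint _ (by simp), ℓ.disjoint _ (by simp),
    fun q hq => ℓ.disjoint q (List.mem_cons_of_mem _ (List.mem_cons_of_mem _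
      (List.mem_cons_of_mem _ (List.mem_cons_of_mem _ hq))))⟩

/-- The angle by which the qubit `b` of `low` is rotated, in the first half of the blocks. -/
noncomputable def angle (j : Fin 2) (b : Q) (t : Fin 2) : ℝ :=
  if t = 0 then (if j = 0 ∨ b = ℓ.low₀ then -(Real.pi / 4) else Real.pi / 4) else 0

/-- The rotations of the field `low`. -/
noncomputable def rot (j : Fin 2) : QubitOp Q :=
  (ℓ.lows.map fun b => mux b fun y => ry (ℓ.angle j b (y ℓ.top))).prod

/-- The rotations of the field `low`, controlled by `j₀`. -/
noncomputable def selRot : QubitOp Q :=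
  (ℓ.lows.map fun b => mux b fun y =>
    ry (if y ℓ.j₀ = 1 then ℓ.angle (y ℓ.j₁) b (y ℓ.top) else 0)).prod

/-- The cyclic shift of the blocks, controlled by `j₁`. -/
def selShift : QubitOp Q :=
  permOp fun y => if Matches [(ℓ.j₁, 1)] y then incr ℓ.blockBits y else y

/-- The coefficient chosen by the selectors and the number of the block. -/
def coeff (c : Fin 2 → Fin 2 → Fin 2 → Bool → ℕ → ℝ) (y : Q → Fin 2) : ℝ :=
  c (y ℓ.j₀) (y ℓ.j₁) (y ℓ.top) (decide (Matches (ℓ.high.map fun q => (q, 0)) y))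
    (bitVal y ℓ.lows)

/-- The rotation of `f` that produces the coefficients. -/
noncomputable def coeffRot (c : Fin 2 → Fin 2 → Fin 2 → Bool → ℕ → ℝ) : QubitOp Q :=
  mux ℓ.f fun y => ry (Real.arccos (ℓ.coeff c y))

/-- The computation of the flag. -/
def flag : QubitOp Q := mux ℓ.g (ctrl [(ℓ.j₀, 0), (ℓ.j₁, 0)] pauliX)

/-- The query, for one value of the selectors. -/
def selQuery (V : QubitOp R) : QubitOp Q :=
  ℓ.flag * ((CircuitStep.query ℓ.g ℓ.w ℓ.w_ne.2.2.2.1 : CircuitStep Q R).op V * ℓ.flag)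

/-- The circuit without the preparation of the selectors. -/
noncomputable def select (c : Fin 2 → Fin 2 → Fin 2 → Bool → ℕ → ℝ) (V : QubitOp R) : QubitOp Q :=
  ℓ.coeffRot c * (ℓ.selShift * (ℓ.selRot * ℓ.selQuery V))

/-- The operator of the circuit. -/
noncomputable def total (c : Fin 2 → Fin 2 → Fin 2 → Bool → ℕ → ℝ) (V : QubitOp R) : QubitOp Q :=
  mux ℓ.j₀ (fun _ => hadamard) *
    ((mux ℓ.j₁ (fun _ => hadamard) * (ℓ.select c V * mux ℓ.j₁ fun _ => hadamard)) *
      mux ℓ.j₀ fun _ => hadamard)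

/-! ### Matrix entries -/

lemma preserves_prod_mux {l : List Q} {q : Q} (hq : q ∉ l)
    (u : Q → (Q → Fin 2) → Matrix (Fin 2) (Fin 2) ℂ) :
    Preserves q (l.map fun b => mux b (u b)).prod := by
  induction l with
  | nil => exact preserves_one q
  | cons b l ih =>
    rw [List.mem_cons, not_or] at hq
    rw [List.map_cons, List.prod_cons]
    exact (preserves_mux hq.1 _).mul (ih hq.2)

lemma preserves_selRot {q : Q} (hq : q ∉ ℓ.blockBits) : Preserves q ℓ.selRot :=
  preserves_prod_mux (fun h => hq (ℓ.lows_subset h)) _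

lemma preserves_selShift {q : Q} (hq : q ∉ ℓ.blockBits) : Preserves q ℓ.selShift :=
  preserves_permOp fun y => by
    split_ifs
    · exact incr_of_notMem hq y
    · rfl

lemma preserves_selQuery (V : QubitOp R) {q : Q} (hq : q ≠ ℓ.g) (hw : ∀ i, ℓ.w i ≠ q) :
    Preserves q (ℓ.selQuery V) :=
  (preserves_mux hq _).mul ((preserves_query V _ _ _ _ hw).mul (preserves_mux hq _))

lemma preserves_select (c : Fin 2 → Fin 2 → Fin 2 → Bool → ℕ → ℝ) (V : QubitOp R) {q : Q}
    (hq : q ∉ ℓ.blockBits) (hf : q ≠ ℓ.f) (hg : q ≠ ℓ.g) (hw : ∀ i, ℓ.w i ≠ q) :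
    Preserves q (ℓ.select c V) :=
  (preserves_mux hf _).mul ((ℓ.preserves_selShift hq).mul
    ((ℓ.preserves_selRot hq).mul (ℓ.preserves_selQuery V hg hw)))

lemma selRot_apply (x y : Q → Fin 2) : ℓ.selRot x y =
    if ∀ q ∉ ℓ.lows, x q = y q then (ℓ.lows.map fun b =>
      ry (if y ℓ.j₀ = 1 then ℓ.angle (y ℓ.j₁) b (y ℓ.top) else 0) (x b) (y b)).prod else 0 := by
  refine prod_mux_apply ℓ.nodup_lows (List.Subset.refl _) (fun b _ x y h => ?_) x y
  have h0 := h ℓ.j₀ fun h => ℓ.notMem_blockBits.1 (ℓ.lows_subset h)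
  have h1 := h ℓ.j₁ fun h => ℓ.notMem_blockBits.2.1 (ℓ.lows_subset h)
  have h2 := h ℓ.top ℓ.top_notMem_lows
  simp only [h0, h1, h2]

lemma rot_apply (j : Fin 2) (x y : Q → Fin 2) : ℓ.rot j x y =
    if ∀ q ∉ ℓ.lows, x q = y q then (ℓ.lows.map fun b =>
      ry (ℓ.angle j b (y ℓ.top)) (x b) (y b)).prod else 0 := by
  refine prod_mux_apply ℓ.nodup_lows (List.Subset.refl _) (fun b _ x y h => ?_) x y
  simp only [h ℓ.top ℓ.top_notMem_lows]

lemma selRot_apply_of_zero {x : Q → Fin 2} (hx : x ℓ.j₀ = 0) (y : Q → Fin 2) :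
    ℓ.selRot x y = (1 : QubitOp Q) x y := by
  have h1 : (ℓ.lows.map fun b => mux b fun _ => (1 : Matrix (Fin 2) (Fin 2) ℂ)).prod = 1 := by
    refine List.prod_eq_one fun M hM => ?_
    obtain ⟨b, -, rfl⟩ := List.mem_map.1 hM
    exact mux_one b
  rw [← h1, selRot_apply, prod_mux_apply ℓ.nodup_lows (List.Subset.refl _) (fun _ _ _ _ _ => rfl)]
  by_cases h : ∀ q ∉ ℓ.lows, x q = y q
  · have h0 := h ℓ.j₀ fun h => ℓ.notMem_blockBits.1 (ℓ.lows_subset h)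
    simp only [← h0, hx, zero_ne_one, if_false, ry_zero]
  · rw [if_neg h, if_neg h]

lemma selRot_apply_of_one {x : Q → Fin 2} (hx : x ℓ.j₀ = 1) (y : Q → Fin 2) :
    ℓ.selRot x y = ℓ.rot (x ℓ.j₁) x y := by
  rw [selRot_apply, rot_apply]
  by_cases h : ∀ q ∉ ℓ.lows, x q = y q
  · have h0 := h ℓ.j₀ fun h => ℓ.notMem_blockBits.1 (ℓ.lows_subset h)
    have h1 := h ℓ.j₁ fun h => ℓ.notMem_blockBits.2.1 (ℓ.lows_subset h)
    simp only [← h0, ← h1, hx, if_true]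
  · rw [if_neg h, if_neg h]

lemma selShift_mul_apply_of_zero {x : Q → Fin 2} (hx : x ℓ.j₁ = 0) (M : QubitOp Q)
    (y : Q → Fin 2) : (ℓ.selShift * M) x y = M x y := by
  rw [Matrix.mul_apply, Finset.sum_eq_single x]
  · simp [selShift, permOp, Matches, hx]
  · intro z _ hz
    rw [mul_eq_zero]; left
    by_cases hz1 : z ℓ.j₁ = 1
    · exact ℓ.preserves_selShift ℓ.notMem_blockBits.2.1 x z (by rw [hx, hz1]; exact zero_ne_one)
    · simp [selShift, permOp, Matches, hz1, Ne.symm hz]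
  · simp

lemma selShift_mul_apply_of_one {x : Q → Fin 2} (hx : x ℓ.j₁ = 1) (M : QubitOp Q)
    (y : Q → Fin 2) : (ℓ.selShift * M) x y = (permOp (incr ℓ.blockBits) * M) x y := by
  rw [Matrix.mul_apply, Matrix.mul_apply]
  refine Finset.sum_congr rfl fun z _ => ?_
  congr 1
  by_cases hz1 : z ℓ.j₁ = 1
  · simp [selShift, permOp, Matches, hz1]
  · have hne : x ℓ.j₁ ≠ z ℓ.j₁ := by rw [hx]; exact Ne.symm hz1
    rw [ℓ.preserves_selShift ℓ.notMem_blockBits.2.1 x z hne,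
      preserves_permOp (incr_of_notMem ℓ.notMem_blockBits.2.1) x z hne]

/-- Needed because the flag is raised during the query, while the entries in question have the flag
at zero. -/
lemma embedOp_update {w : R ↪ Q} (V : QubitOp R) {q : Q} (hq : ∀ i, w i ≠ q) {x y : Q → Fin 2}
    (h : x q = y q) (b : Fin 2) :
    embedOp w V (Function.update x q b) (Function.update y q b) = embedOp w V x y := by
  have hw : ∀ z : Q → Fin 2, Function.update z q b ∘ w = z ∘ w := fun z => by
    funext i
    simp [Function.update_of_ne (hq i)]
  have hiff : (∀ r, (∀ i, w i ≠ r) → Function.update x q b r = Function.update y q b r) ↔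
      ∀ r, (∀ i, w i ≠ r) → x r = y r := by
    refine forall₂_congr fun r _ => ?_
    by_cases hr : r = q
    · subst hr; simp [h]
    · simp [hr]
  simp only [embedOp, Matrix.of_apply, hiff, hw]

lemma flag_involutive : Function.Involutive fun y : Q → Fin 2 =>
    if Matches [(ℓ.j₀, 0), (ℓ.j₁, 0)] y then Function.update y ℓ.g (y ℓ.g + 1) else y := by
  intro y
  have hg : ℓ.g ∉ ([(ℓ.j₀, 0), (ℓ.j₁, 0)] : List (Q × Fin 2)).map Prod.fst := by
    have := ℓ.ancilla_ne
    simp [this.2.2.1.symm, this.2.2.2.2.1.symm]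
  by_cases h : Matches [(ℓ.j₀, 0), (ℓ.j₁, 0)] y
  · simp only [h, if_true, matches_update hg, Function.update_self, Function.update_idem]
    have : y ℓ.g + 1 + 1 = y ℓ.g := by
      generalize y ℓ.g = a
      fin_cases a <;> rfl
    rw [this, Function.update_eq_self]
  · simp only [h, if_false]

lemma selQuery_apply (V : QubitOp R) (x y : Q → Fin 2) : ℓ.selQuery V x y =
    (CircuitStep.query ℓ.g ℓ.w ℓ.w_ne.2.2.2.1 : CircuitStep Q R).op V
      (if Matches [(ℓ.j₀, 0), (ℓ.j₁, 0)] x then Function.update x ℓ.g (x ℓ.g + 1) else x)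
      (if Matches [(ℓ.j₀, 0), (ℓ.j₁, 0)] y then Function.update y ℓ.g (y ℓ.g + 1) else y) := by
  rw [selQuery, flag, mux_ctrl_pauliX_eq_permOp, permOp_mul_apply ℓ.flag_involutive,
    mul_permOp_apply]

lemma selQuery_apply_of_zero (V : QubitOp R) {x y : Q → Fin 2} (hx0 : x ℓ.j₀ = 0)
    (hx1 : x ℓ.j₁ = 0) (hxg : x ℓ.g = 0) (hy0 : y ℓ.j₀ = 0) (hy1 : y ℓ.j₁ = 0) (hyg : y ℓ.g = 0) :
    ℓ.selQuery V x y = embedOp ℓ.w V x y := by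
  have hx : Matches [(ℓ.j₀, 0), (ℓ.j₁, 0)] x := by simp [Matches, hx0, hx1]
  have hy : Matches [(ℓ.j₀, 0), (ℓ.j₁, 0)] y := by simp [Matches, hy0, hy1]
  rw [selQuery_apply, if_pos hx, if_pos hy, hxg, hyg]
  simp only [CircuitStep.op, Matrix.of_apply, Function.update_self, zero_add, if_true]
  exact embedOp_update V ℓ.w_ne.2.2.2.1 (hxg.trans hyg.symm) 1

/-- The flag stays off, so the query acts as the identity and the two computations of the flag
cancel. -/
lemma selQuery_apply_of_ne (V : QubitOp R) {y : Q → Fin 2} (hy : y ℓ.j₀ ≠ 0 ∨ y ℓ.j₁ ≠ 0)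
    (hyg : y ℓ.g = 0) (x : Q → Fin 2) : ℓ.selQuery V x y = (1 : QubitOp Q) x y := by
  have hy' : ¬ Matches [(ℓ.j₀, 0), (ℓ.j₁, 0)] y := by
    simp only [Matches, List.forall_mem_cons, not_and_or]
    tauto
  rw [selQuery_apply, if_neg hy']
  simp only [CircuitStep.op, Matrix.of_apply, hyg, zero_ne_one, if_false, Matrix.one_apply]
  congr 1
  rw [eq_iff_iff]
  have := ℓ.flag_involutive.eq_iff (x := x) (y := y)
  simp only [hy', if_false] at this
  exact this.trans ⟨fun h => h.symm ▸ rfl, fun h => h ▸ rfl⟩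

lemma selRot_mul_selQuery_apply (V : QubitOp R) {y : Q → Fin 2}
    (hy : y ℓ.j₀ ≠ 0 ∨ y ℓ.j₁ ≠ 0) (hyg : y ℓ.g = 0) (x : Q → Fin 2) :
    (ℓ.selRot * ℓ.selQuery V) x y = ℓ.selRot x y := by
  rw [Matrix.mul_apply]
  simp only [ℓ.selQuery_apply_of_ne V hy hyg]
  rw [← Matrix.mul_apply, mul_one]

/-- The shift changes qubits of `l` only, so a row of the product involves only rows with the same
values elsewhere, in particular at the selectors. -/
lemma permOp_mul_congr_row {l : List Q} {M N : QubitOp Q} {x : Q → Fin 2}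
    (y : Q → Fin 2) (h : ∀ z, (∀ q ∉ l, z q = x q) → M z y = N z y) :
    (permOp (incr l) * M) x y = (permOp (incr l) * N) x y := by
  rw [Matrix.mul_apply, Matrix.mul_apply]
  refine Finset.sum_congr rfl fun z _ => ?_
  by_cases hz : ∀ q ∉ l, z q = x q
  · rw [h z hz]
  · push Not at hz
    obtain ⟨q, hq, hne⟩ := hz
    rw [preserves_permOp (incr_of_notMem hq) x z (Ne.symm hne), zero_mul, zero_mul]

lemma indep_coeff (c : Fin 2 → Fin 2 → Fin 2 → Bool → ℕ → ℝ) : Indep ℓ.f (ℓ.coeff c) := by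
  intro y b
  have hn := ℓ.ancilla_ne
  have hf := ℓ.notMem_blockBits.2.2.1
  have h1 : ℓ.f ∉ (ℓ.high.map fun q => ((q, 0) : Q × Fin 2)).map Prod.fst := by
    rw [List.map_map]
    simp only [Function.comp_def, List.map_id']
    exact fun h => hf (ℓ.high_subset h)
  have h2 : bitVal (Function.update y ℓ.f b) ℓ.lows = bitVal y ℓ.lows := bitVal_congr fun q hq =>
    Function.update_of_ne (fun h => hf (ℓ.lows_subset (by rw [← h]; exact hq))) _ _
  simp only [coeff, matches_update h1, h2, Function.update_of_ne hn.2.1,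
    Function.update_of_ne hn.2.2.2.1, Function.update_of_ne
    (show ℓ.top ≠ ℓ.f from fun h => hf (by rw [← h]; exact ℓ.top_mem))]

/-- The rotation of `f` is the last of these operators, so the coefficient is evaluated at the row
`x`. Between states with `f = 0` only the cosine of `arccos` survives. -/
lemma coeffRot_mul_apply {c : Fin 2 → Fin 2 → Fin 2 → Bool → ℕ → ℝ}
    (hc : ∀ a b t z r, |c a b t z r| ≤ 1) {M : QubitOp Q} (hM : Preserves ℓ.f M) {x y : Q → Fin 2}
    (hx : x ℓ.f = 0) (hy : y ℓ.f = 0) :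
    (ℓ.coeffRot c * M) x y = (ℓ.coeff c x : ℂ) * M x y := by
  have hi : Indep ℓ.f fun y => ry (Real.arccos (ℓ.coeff c y)) := fun y b => by
    simp only [ℓ.indep_coeff c y b]
  rw [coeffRot, mux_mul_apply hi, Fin.sum_univ_two, hM (Function.update x ℓ.f 1) y (by simp [hy]),
    hx]
  have h1 : Function.update x ℓ.f 0 = x := by rw [← hx, Function.update_eq_self]
  have h2 : -1 ≤ ℓ.coeff c x ∧ ℓ.coeff c x ≤ 1 := abs_le.1 (hc _ _ _ _ _)
  rw [h1, mul_zero, add_zero]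
  simp only [ry, Matrix.of_apply, Matrix.cons_val', Matrix.cons_val_zero, Matrix.cons_val_fin_one]
  rw [Real.cos_arccos h2.1 h2.2]

variable {c : Fin 2 → Fin 2 → Fin 2 → Bool → ℕ → ℝ}

lemma select_apply (hc : ∀ a b t z r, |c a b t z r| ≤ 1) (V : QubitOp R) {x y : Q → Fin 2}
    (hxf : x ℓ.f = 0) (hyf : y ℓ.f = 0) : ℓ.select c V x y =
      ℓ.coeff c x * (ℓ.selShift * (ℓ.selRot * ℓ.selQuery V)) x y :=
  ℓ.coeffRot_mul_apply hc ((ℓ.preserves_selShift ℓ.notMem_blockBits.2.2.1).mul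
    ((ℓ.preserves_selRot ℓ.notMem_blockBits.2.2.1).mul (ℓ.preserves_selQuery V ℓ.ancilla_ne.2.2.2.2.2
      ℓ.w_ne.2.2.1))) hxf hyf

/-- This lemma and the next three: each value of the selectors leaves one of the four operators,
with its row coefficients. -/
lemma select_apply_zero_zero (hc : ∀ a b t z r, |c a b t z r| ≤ 1) (V : QubitOp R)
    {x y : Q → Fin 2} (hxf : x ℓ.f = 0) (hyf : y ℓ.f = 0) (hxg : x ℓ.g = 0) (hyg : y ℓ.g = 0)
    (hx0 : x ℓ.j₀ = 0) (hx1 : x ℓ.j₁ = 0) (hy0 : y ℓ.j₀ = 0) (hy1 : y ℓ.j₁ = 0) :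
    ℓ.select c V x y = ℓ.coeff c x * embedOp ℓ.w V x y := by
  rw [ℓ.select_apply hc V hxf hyf, selShift_mul_apply_of_zero ℓ hx1, Matrix.mul_apply]
  simp only [ℓ.selRot_apply_of_zero hx0]
  rw [← Matrix.mul_apply, one_mul, ℓ.selQuery_apply_of_zero V hx0 hx1 hxg hy0 hy1 hyg]

lemma select_apply_one_zero (hc : ∀ a b t z r, |c a b t z r| ≤ 1) (V : QubitOp R)
    {x y : Q → Fin 2} (hxf : x ℓ.f = 0) (hyf : y ℓ.f = 0) (hyg : y ℓ.g = 0)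
    (hx0 : x ℓ.j₀ = 1) (hx1 : x ℓ.j₁ = 0) (hy0 : y ℓ.j₀ = 1) :
    ℓ.select c V x y = ℓ.coeff c x * ℓ.rot 0 x y := by
  rw [ℓ.select_apply hc V hxf hyf, selShift_mul_apply_of_zero ℓ hx1,
    ℓ.selRot_mul_selQuery_apply V (Or.inl (by rw [hy0]; exact one_ne_zero)) hyg,
    ℓ.selRot_apply_of_one hx0, hx1]

lemma select_apply_zero_one (hc : ∀ a b t z r, |c a b t z r| ≤ 1) (V : QubitOp R)
    {x y : Q → Fin 2} (hxf : x ℓ.f = 0) (hyf : y ℓ.f = 0) (hyg : y ℓ.g = 0)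
    (hx0 : x ℓ.j₀ = 0) (hx1 : x ℓ.j₁ = 1) (hy1 : y ℓ.j₁ = 1) :
    ℓ.select c V x y = ℓ.coeff c x * permOp (incr ℓ.blockBits) x y := by
  rw [ℓ.select_apply hc V hxf hyf, selShift_mul_apply_of_one ℓ hx1,
    permOp_mul_congr_row (N := 1) y, mul_one]
  intro z hz
  rw [ℓ.selRot_mul_selQuery_apply V (Or.inr (by rw [hy1]; exact one_ne_zero)) hyg,
    ℓ.selRot_apply_of_zero ((hz _ ℓ.notMem_blockBits.1).trans hx0)]

lemma select_apply_one_one (hc : ∀ a b t z r, |c a b t z r| ≤ 1) (V : QubitOp R)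
    {x y : Q → Fin 2} (hxf : x ℓ.f = 0) (hyf : y ℓ.f = 0) (hyg : y ℓ.g = 0)
    (hx0 : x ℓ.j₀ = 1) (hx1 : x ℓ.j₁ = 1) (hy1 : y ℓ.j₁ = 1) :
    ℓ.select c V x y = ℓ.coeff c x * (permOp (incr ℓ.blockBits) * ℓ.rot 1) x y := by
  rw [ℓ.select_apply hc V hxf hyf, selShift_mul_apply_of_one ℓ hx1,
    permOp_mul_congr_row (N := ℓ.rot 1) y]
  intro z hz
  rw [ℓ.selRot_mul_selQuery_apply V (Or.inr (by rw [hy1]; exact one_ne_zero)) hyg,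
    ℓ.selRot_apply_of_one ((hz _ ℓ.notMem_blockBits.1).trans hx0),
    (hz _ ℓ.notMem_blockBits.2.1).trans hx1]

/-- The basis state `x` with the values `a` and `b` of the selectors. -/
def setSel (x : Q → Fin 2) (a b : Fin 2) : Q → Fin 2 :=
  Function.update (Function.update x ℓ.j₀ a) ℓ.j₁ b

lemma setSel_j₀ (x : Q → Fin 2) (a b : Fin 2) : ℓ.setSel x a b ℓ.j₀ = a := by
  rw [setSel, Function.update_of_ne ℓ.ancilla_ne.1, Function.update_self]

lemma setSel_j₁ (x : Q → Fin 2) (a b : Fin 2) : ℓ.setSel x a b ℓ.j₁ = b := by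
  rw [setSel, Function.update_self]

lemma setSel_of_ne (x : Q → Fin 2) (a b : Fin 2) {q : Q} (h0 : q ≠ ℓ.j₀) (h1 : q ≠ ℓ.j₁) :
    ℓ.setSel x a b q = x q := by
  rw [setSel, Function.update_of_ne h1, Function.update_of_ne h0]

/-- The entries of the circuit between basis states whose ancillas are zero. -/
lemma total_apply (hc : ∀ a b t z r, |c a b t z r| ≤ 1) (V : QubitOp R) {x y : Q → Fin 2}
    (hx : x ℓ.j₀ = 0 ∧ x ℓ.j₁ = 0 ∧ x ℓ.f = 0 ∧ x ℓ.g = 0)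
    (hy : y ℓ.j₀ = 0 ∧ y ℓ.j₁ = 0 ∧ y ℓ.f = 0 ∧ y ℓ.g = 0) :
    ℓ.total c V x y = 1 / 4 *
      (ℓ.coeff c (ℓ.setSel x 0 0) * embedOp ℓ.w V (ℓ.setSel x 0 0) (ℓ.setSel y 0 0) +
        ℓ.coeff c (ℓ.setSel x 1 0) * ℓ.rot 0 (ℓ.setSel x 1 0) (ℓ.setSel y 1 0) +
        ℓ.coeff c (ℓ.setSel x 0 1) *
          permOp (incr ℓ.blockBits) (ℓ.setSel x 0 1) (ℓ.setSel y 0 1) +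
        ℓ.coeff c (ℓ.setSel x 1 1) *
          (permOp (incr ℓ.blockBits) * ℓ.rot 1) (ℓ.setSel x 1 1) (ℓ.setSel y 1 1)) := by
  obtain ⟨hx0, hx1, hxf, hxg⟩ := hx
  obtain ⟨hy0, hy1, hyf, hyg⟩ := hy
  obtain ⟨n1, n2, n3, n4, n5, n6⟩ := ℓ.ancilla_ne
  obtain ⟨m0, m1, mf, mg⟩ := ℓ.notMem_blockBits
  obtain ⟨w0, w1, wf, wg, -⟩ := ℓ.w_ne
  have p0 := ℓ.preserves_select c V m0 n2 n3 w0
  have p1 := ℓ.preserves_select c V m1 n4 n5 w1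
  have hf : ∀ (z : Q → Fin 2) (a b : Fin 2), z ℓ.f = 0 → ℓ.setSel z a b ℓ.f = 0 :=
    fun z a b h => (ℓ.setSel_of_ne z a b n2.symm n4.symm).trans h
  have hg : ∀ (z : Q → Fin 2) (a b : Fin 2), z ℓ.g = 0 → ℓ.setSel z a b ℓ.g = 0 :=
    fun z a b h => (ℓ.setSel_of_ne z a b n3.symm n5.symm).trans h
  have hj : ∀ (z : Q → Fin 2) (a : Fin 2), z ℓ.j₁ = 0 → Function.update z ℓ.j₀ a ℓ.j₁ = 0 :=
    fun z a h => by rw [Function.update_of_ne n1.symm, h]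
  rw [total, hadamard_sandwich_apply
    ((preserves_mux n1 _).mul (p0.mul (preserves_mux n1 _))) hx0 hy0,
    hadamard_sandwich_apply p1 (hj x 0 hx1) (hj y 0 hy1),
    hadamard_sandwich_apply p1 (hj x 1 hx1) (hj y 1 hy1)]
  have e : ∀ (z : Q → Fin 2) (a b : Fin 2),
    Function.update (Function.update z ℓ.j₀ a) ℓ.j₁ b = ℓ.setSel z a b := fun _ _ _ => rfl
  simp only [e]
  rw [ℓ.select_apply_zero_zero hc V (hf _ _ _ hxf) (hf _ _ _ hyf) (hg _ _ _ hxg) (hg _ _ _ hyg)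
      (ℓ.setSel_j₀ _ _ _) (ℓ.setSel_j₁ _ _ _) (ℓ.setSel_j₀ _ _ _) (ℓ.setSel_j₁ _ _ _),
    ℓ.select_apply_one_zero hc V (hf _ _ _ hxf) (hf _ _ _ hyf) (hg _ _ _ hyg)
      (ℓ.setSel_j₀ _ _ _) (ℓ.setSel_j₁ _ _ _) (ℓ.setSel_j₀ _ _ _),
    ℓ.select_apply_zero_one hc V (hf _ _ _ hxf) (hf _ _ _ hyf) (hg _ _ _ hyg)
      (ℓ.setSel_j₀ _ _ _) (ℓ.setSel_j₁ _ _ _) (ℓ.setSel_j₁ _ _ _),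
    ℓ.select_apply_one_one hc V (hf _ _ _ hxf) (hf _ _ _ hyf) (hg _ _ _ hyg)
      (ℓ.setSel_j₀ _ _ _) (ℓ.setSel_j₁ _ _ _) (ℓ.setSel_j₁ _ _ _)]
  ring

/-! ### Size -/

/-- The number with the binary digits `l`, least significant digit first. -/
def listVal : List (Fin 2) → ℕ
  | [] => 0
  | b :: l => b.val + 2 * listVal l

lemma listVal_map (y : Q → Fin 2) : ∀ l : List Q, listVal (l.map y) = bitVal y l
  | [] => rfl
  | b :: l => by rw [List.map_cons, listVal, listVal_map y l, bitVal]

/-- The linear term of the gate count arises here: the coefficients are arbitrary functions of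
`lows` and three further qubits. The field `high` enters through a single predicate, at quadratic
cost. -/
lemma synth_coeffRot (c : Fin 2 → Fin 2 → Fin 2 → Bool → ℕ → ℝ) :
    Synth R (ℓ.coeffRot c) (2 * (3 * 2 ^ (ℓ.lows.length + 3)) +
      2 * (12 * (ℓ.high.length + 1) ^ 2 + 10)) := by
  obtain ⟨n1, n2, n3, n4, n5, n6⟩ := ℓ.ancilla_ne
  obtain ⟨m0, m1, mf, mg⟩ := ℓ.notMem_blockBits
  have hfst : (ℓ.high.map fun q => ((q, 0) : Q × Fin 2)).map Prod.fst = ℓ.high := by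
    rw [List.map_map]
    simp only [Function.comp_def, List.map_id']
  have hl : ℓ.f ∉ ℓ.j₀ :: ℓ.j₁ :: ℓ.top :: ℓ.lows := by
    simp only [List.mem_cons, not_or]
    exact ⟨n2.symm, n4.symm, fun h => mf (by rw [h]; exact ℓ.top_mem),
      fun h => mf (ℓ.lows_subset h)⟩
  have hf : ℓ.f ∉ (ℓ.high.map fun q => ((q, 0) : Q × Fin 2)).map Prod.fst := by
    rw [hfst]; exact fun h => mf (ℓ.high_subset h)
  have hg : ℓ.g ∉ (ℓ.high.map fun q => ((q, 0) : Q × Fin 2)).map Prod.fst := by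
    rw [hfst]; exact fun h => mg (ℓ.high_subset h)
  have h := (synthRy_map (R := R) _ hl).prod_decide (indep_map hl)
    (P := Matches (ℓ.high.map fun q => (q, 0))) (fun y b => propext (matches_update hf y b))
    (synth_ctrl_pauliX hf hg n6.symm)
  -- The list consists of `j₀`, `j₁`, `top` and the digits of `lows`; the last case never occurs.
  let ψ : Bool × List (Fin 2) → ℝ := fun x =>
    match x.2 with
    | a :: b :: t :: l => Real.arccos (c a b t x.1 (listVal l))
    | _ => 0
  refine ((h ψ).congr_mux fun y => ?_).mono ?_
  · simp only [ψ, List.map_cons, listVal_map]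
    rfl
  · simp only [List.length_cons, List.length_map]
    rw [show ℓ.lows.length + 1 + 1 + 1 = ℓ.lows.length + 3 from rfl]
    omega

lemma synth_selShift : Synth R ℓ.selShift
    (ℓ.blockBits.length * (12 * (1 + ℓ.blockBits.length) ^ 2 + 10)) := by
  obtain ⟨n1, n2, n3, n4, n5, n6⟩ := ℓ.ancilla_ne
  obtain ⟨m0, m1, mf, mg⟩ := ℓ.notMem_blockBits
  refine synth_ctrl_incr (d := ℓ.f) ℓ.nodup_blockBits (fun q hq => ?_) mf (by simpa using n4.symm)
  simp only [List.map_cons, List.map_nil, List.mem_singleton]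
  rintro rfl
  exact m1 hq

lemma synth_selRot : Synth R ℓ.selRot (ℓ.lows.length * 22) := by
  have key : ∀ l : List Q, l ⊆ ℓ.lows → Synth R (l.map fun b => mux b fun y =>
      ry (if y ℓ.j₀ = 1 then ℓ.angle (y ℓ.j₁) b (y ℓ.top) else 0)).prod (l.length * 22) := by
    intro l
    induction l with
    | nil => exact fun _ => synth_one.mono (Nat.zero_le _)
    | cons b l ih =>
      intro hl
      have hb : b ∈ ℓ.lows := hl (by simp)
      have hb' : b ∉ [ℓ.j₀, ℓ.j₁, ℓ.top] := by
        simp only [List.mem_cons, List.not_mem_nil, or_false, not_or]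
        refine ⟨?_, ?_, ?_⟩ <;> rintro rfl
        · exact ℓ.notMem_blockBits.1 (ℓ.lows_subset hb)
        · exact ℓ.notMem_blockBits.2.1 (ℓ.lows_subset hb)
        · exact ℓ.top_notMem_lows hb
      let ψ : List (Fin 2) → ℝ := fun x =>
        match x with
        | [a, j, t] => if a = 1 then ℓ.angle j b t else 0
        | _ => 0
      have h1 := synthRy_map (R := R) _ hb' ψ
      rw [List.map_cons, List.prod_cons]
      refine (Synth.mul (g := 22) (h1.congr_mux fun y => rfl)
        (ih fun q hq => hl (by simp [hq]))).mono ?_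
      rw [List.length_cons]; omega
  exact key _ (List.Subset.refl _)

lemma synth_flag : Synth R ℓ.flag 118 := by
  obtain ⟨n1, n2, n3, n4, n5, n6⟩ := ℓ.ancilla_ne
  refine synth_ctrl_pauliX (d := ℓ.f) ?_ ?_ n6
  · simp [n3.symm, n5.symm]
  · simp [n2.symm, n4.symm]

/-- The number of gates of the circuit. -/
def size : ℕ := 240 + ℓ.lows.length * 22 +
  ℓ.blockBits.length * (12 * (1 + ℓ.blockBits.length) ^ 2 + 10) +
  (2 * (3 * 2 ^ (ℓ.lows.length + 3)) + 2 * (12 * (ℓ.high.length + 1) ^ 2 + 10))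

lemma exists_circuit (c : Fin 2 → Fin 2 → Fin 2 → Bool → ℕ → ℝ) :
    ∃ circ : List (CircuitStep Q R), queryCount circ = 1 ∧ gateCount circ ≤ ℓ.size ∧
      ∀ V, circuitOp V circ = ℓ.total c V := by
  have h0 := synth_single (R := R) ℓ.j₀ hadamard_mem
  have h1 := synth_single (R := R) ℓ.j₁ hadamard_mem
  obtain ⟨pre, a1, a2, a3⟩ := ℓ.synth_flag.mul (h1.mul h0)
  obtain ⟨post, b1, b2, b3⟩ := h0.mul (h1.mul ((ℓ.synth_coeffRot c).mul
    (ℓ.synth_selShift.mul (ℓ.synth_selRot.mul ℓ.synth_flag))))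
  refine ⟨pre ++ .query ℓ.g ℓ.w ℓ.w_ne.2.2.2.1 :: post, ?_, ?_, fun V => ?_⟩
  · rw [queryCount_append, queryCount_cons_query, a1, b1]
  -- The `240` in `size` is two flags of `118` gates each and four Hadamard gates.
  · rw [gateCount_append, gateCount_cons_query, size]
    omega
  · rw [circuitOp_append, circuitOp, a3, b3]
    simp only [total, select, selQuery, Matrix.mul_assoc]

end Layout

end Assembly

/-! ### Basis states and numbers -/

section Numbers

/-- The system qubit of weight `2 ^ i`. -/
def sysQ (d s i : ℕ) : Fin (d + 5) ⊕ Fin s := if h : i < s then .inr ⟨i, h⟩ else .inl 0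

lemma sysQ_of_lt {d s i : ℕ} (h : i < s) : sysQ d s i = .inr ⟨i, h⟩ := dif_pos h

lemma sysQ_injOn {d s i j : ℕ} (hi : i < s) (hj : j < s) (h : sysQ d s i = sysQ d s j) :
    i = j := by
  rw [sysQ_of_lt hi, sysQ_of_lt hj] at h
  simpa using h

/-- The consecutive system qubits `a, …, a + l - 1`. -/
def sysQs (d s a l : ℕ) : List (Fin (d + 5) ⊕ Fin s) := (List.range' a l).map (sysQ d s)

lemma sysQs_succ (d s a l : ℕ) : sysQs d s a (l + 1) = sysQ d s a :: sysQs d s (a + 1) l := by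
  rw [sysQs, List.range'_succ, List.map_cons, sysQs]

lemma sysQs_append (d s a l l' : ℕ) :
    sysQs d s a l ++ sysQs d s (a + l) l' = sysQs d s a (l + l') := by
  have := List.range'_append (s := a) (m := l) (n := l') (step := 1)
  rw [one_mul] at this
  rw [sysQs, sysQs, sysQs, ← List.map_append, this]

lemma length_sysQs (d s a l : ℕ) : (sysQs d s a l).length = l := by simp [sysQs]

lemma mem_sysQs {d s a l : ℕ} {q : Fin (d + 5) ⊕ Fin s} (h : a + l ≤ s) :
    q ∈ sysQs d s a l ↔ ∃ i : Fin s, q = .inr i ∧ a ≤ i.val ∧ i.val < a + l := by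
  simp only [sysQs, List.mem_map, List.mem_range'_1]
  constructor
  · rintro ⟨i, ⟨h1, h2⟩, rfl⟩
    exact ⟨⟨i, by omega⟩, sysQ_of_lt _, h1, h2⟩
  · rintro ⟨i, rfl, h1, h2⟩
    exact ⟨i, ⟨h1, h2⟩, sysQ_of_lt i.2⟩

lemma nodup_sysQs {d s a l : ℕ} (h : a + l ≤ s) : (sysQs d s a l).Nodup := by
  refine List.Nodup.map_on (fun i hi j hj hij => ?_) List.nodup_range'
  rw [List.mem_range'_1] at hi hj
  exact sysQ_injOn (by omega) (by omega) hij

/-- The basis state with the ancillas `u` and the system qubits in the basis state number `X`. -/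
def basisState {d s : ℕ} (u : Fin (d + 5) → Fin 2) (X : ℕ) : Fin (d + 5) ⊕ Fin s → Fin 2 :=
  Sum.elim u fun i => ⟨X / 2 ^ i.val % 2, Nat.mod_lt _ two_pos⟩

variable {d s : ℕ} (u : Fin (d + 5) → Fin 2)

lemma basisState_sysQ (X : ℕ) {i : ℕ} (h : i < s) :
    (basisState u X (sysQ d s i)).val = X / 2 ^ i % 2 := by
  rw [sysQ_of_lt h]; rfl

lemma bitVal_basisState (X : ℕ) {a l : ℕ} (h : a + l ≤ s) :
    bitVal (basisState u X) (sysQs d s a l) = X / 2 ^ a % 2 ^ l := by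
  induction l generalizing a with
  | zero => simp [sysQs, bitVal, Nat.mod_one]
  | succ l ih =>
    rw [sysQs_succ, bitVal, basisState_sysQ u X (by omega), ih (by omega), pow_succ 2 l,
      mul_comm (2 ^ l) 2, Nat.mod_mul, pow_succ, Nat.div_div_eq_div_mul]

lemma basisState_eq_iff (X Y : ℕ) {a l : ℕ} (h : a + l ≤ s) :
    (∀ q ∈ sysQs d s a l, basisState u X q = basisState u Y q) ↔
      X / 2 ^ a % 2 ^ l = Y / 2 ^ a % 2 ^ l := by
  rw [← bitVal_basisState u X h, ← bitVal_basisState u Y h]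
  exact ⟨bitVal_congr, eq_of_bitVal_eq⟩

lemma basisState_injective {X Y : ℕ} (hX : X < 2 ^ s) (hY : Y < 2 ^ s)
    (h : (basisState u X : Fin (d + 5) ⊕ Fin s → Fin 2) = basisState u Y) : X = Y := by
  have := (basisState_eq_iff (s := s) u X Y (a := 0) (l := s) (by omega)).1 fun q _ => by rw [h]
  simpa [Nat.mod_eq_of_lt hX, Nat.mod_eq_of_lt hY] using this

end Numbers

/-! ### The concrete layout and its operators on numbered basis states. -/

section Layout

variable (𝔪 κ 𝔫 𝔡 : ℕ)

/-- The number of system qubits. -/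
abbrev numSys : ℕ := 1 + 𝔪 + (κ + 1) + 𝔫

/-- The embedding of the qubits of the oracle. -/
def oracleEmb : Fin 𝔡 ⊕ Fin 𝔫 ↪ Fin (𝔡 + 5) ⊕ Fin (numSys 𝔪 κ 𝔫) where
  toFun := Sum.map (Fin.castAdd 5) (Fin.castLE (by unfold numSys; omega))
  inj' := Function.Injective.sumMap (Fin.castAdd_injective _ _) (Fin.castLE_injective _)

lemma blockBits_eq : (sysQ 𝔡 (numSys 𝔪 κ 𝔫) 𝔫 :: sysQs 𝔡 (numSys 𝔪 κ 𝔫) (𝔫 + 1) κ) ++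
    (sysQs 𝔡 (numSys 𝔪 κ 𝔫) (𝔫 + (κ + 1)) 𝔪 ++ [sysQ 𝔡 (numSys 𝔪 κ 𝔫) (𝔫 + (κ + 1) + 𝔪)]) =
      sysQs 𝔡 (numSys 𝔪 κ 𝔫) 𝔫 (κ + 1 + (𝔪 + 1)) := by
  rw [← sysQs_succ, show [sysQ 𝔡 (numSys 𝔪 κ 𝔫) (𝔫 + (κ + 1) + 𝔪)] =
    sysQs 𝔡 (numSys 𝔪 κ 𝔫) (𝔫 + (κ + 1) + 𝔪) 1 from rfl, sysQs_append, sysQs_append]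

/-- The layout of the circuit: the last five ancillas are the work qubits. -/
def padeLayout : Layout (Fin (𝔡 + 5) ⊕ Fin (numSys 𝔪 κ 𝔫)) (Fin 𝔡 ⊕ Fin 𝔫) where
  j₀ := .inl (Fin.natAdd 𝔡 0)
  j₁ := .inl (Fin.natAdd 𝔡 1)
  f := .inl (Fin.natAdd 𝔡 2)
  g := .inl (Fin.natAdd 𝔡 3)
  low₀ := sysQ _ _ 𝔫
  low := sysQs _ _ (𝔫 + 1) κ
  high := sysQs _ _ (𝔫 + (κ + 1)) 𝔪
  top := sysQ _ _ (𝔫 + (κ + 1) + 𝔪)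
  w := oracleEmb 𝔪 κ 𝔫 𝔡
  nodup := by
    rw [blockBits_eq]
    have h : 𝔫 + (κ + 1 + (𝔪 + 1)) ≤ numSys 𝔪 κ 𝔫 := by unfold numSys; omega
    have hn : ∀ a : Fin (𝔡 + 5), (.inl a : Fin (𝔡 + 5) ⊕ Fin (numSys 𝔪 κ 𝔫)) ∉
        sysQs 𝔡 (numSys 𝔪 κ 𝔫) 𝔫 (κ + 1 + (𝔪 + 1)) := fun a ha => by
      obtain ⟨i, hi, -⟩ := (mem_sysQs h).1 ha
      cases hi
    simp only [List.nodup_cons, List.mem_cons, hn, Sum.inl.injEq, nodup_sysQs h]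
    simp [Fin.ext_iff]
  disjoint := by
    rw [blockBits_eq]
    have h : 𝔫 + (κ + 1 + (𝔪 + 1)) ≤ numSys 𝔪 κ 𝔫 := by unfold numSys; omega
    intro q hq i hi
    simp only [List.mem_cons, mem_sysQs h] at hq
    subst hi
    rcases i with i | i
    · simp [oracleEmb, Fin.ext_iff] at hq
      omega
    · simp [oracleEmb, Fin.ext_iff] at hq
      omega

variable {𝔪 κ 𝔫 𝔡}

lemma padeLayout_blockBits :
    (padeLayout 𝔪 κ 𝔫 𝔡).blockBits = sysQs 𝔡 (numSys 𝔪 κ 𝔫) 𝔫 (κ + 1 + (𝔪 + 1)) :=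
  blockBits_eq 𝔪 κ 𝔫 𝔡

lemma padeLayout_lows :
    (padeLayout 𝔪 κ 𝔫 𝔡).lows = sysQs 𝔡 (numSys 𝔪 κ 𝔫) 𝔫 (κ + 1) :=
  (sysQs_succ _ _ _ _).symm

variable (u : Fin (𝔡 + 5) → Fin 2)

lemma div_lt_of_lt_numSys {X : ℕ} (hX : X < 2 ^ numSys 𝔪 κ 𝔫) :
    X / 2 ^ 𝔫 < 2 ^ (κ + 1 + (𝔪 + 1)) := by
  rw [Nat.div_lt_iff_lt_mul (by positivity), ← pow_add]
  refine hX.trans_eq (congrArg _ ?_)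
  unfold numSys; omega

/-- The agreement of basis states on the qubits of the rows of a block. -/
lemma agree_inner_iff (X Y : ℕ) :
    (∀ i : Fin (numSys 𝔪 κ 𝔫), i.val < 𝔫 → (basisState u X : _ → Fin 2) (.inr i) =
      basisState u Y (.inr i)) ↔ X % 2 ^ 𝔫 = Y % 2 ^ 𝔫 := by
  have h : 0 + 𝔫 ≤ numSys 𝔪 κ 𝔫 := by unfold numSys; omega
  have := basisState_eq_iff u X Y h
  simp only [pow_zero, Nat.div_one] at this
  rw [← this]
  constructor
  · intro H q hq
    obtain ⟨i, rfl, -, hi⟩ := (mem_sysQs h).1 hq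
    exact H i (by omega)
  · intro H i hi
    exact H _ ((mem_sysQs h).2 ⟨i, rfl, Nat.zero_le _, by omega⟩)

lemma agree_outer_iff (X Y a l : ℕ) (h : a + l = numSys 𝔪 κ 𝔫) (hX : X < 2 ^ numSys 𝔪 κ 𝔫)
    (hY : Y < 2 ^ numSys 𝔪 κ 𝔫) :
    (∀ i : Fin (numSys 𝔪 κ 𝔫), a ≤ i.val → (basisState u X : _ → Fin 2) (.inr i) =
      basisState u Y (.inr i)) ↔ X / 2 ^ a = Y / 2 ^ a := by
  have := basisState_eq_iff u X Y h.le
  have hlt : ∀ Z, Z < 2 ^ numSys 𝔪 κ 𝔫 → Z / 2 ^ a < 2 ^ l := fun Z hZ => by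
    rw [Nat.div_lt_iff_lt_mul (by positivity), ← pow_add, add_comm l, h]
    exact hZ
  rw [Nat.mod_eq_of_lt (hlt X hX), Nat.mod_eq_of_lt (hlt Y hY)] at this
  rw [← this]
  constructor
  · intro H q hq
    obtain ⟨i, rfl, hi, -⟩ := (mem_sysQs h.le).1 hq
    exact H i (by omega)
  · intro H i hi
    exact H _ ((mem_sysQs h.le).2 ⟨i, rfl, hi, by omega⟩)

lemma incr_basisState {Y : ℕ} :
    incr (padeLayout 𝔪 κ 𝔫 𝔡).blockBits (basisState u Y) =
      basisState u ((Y / 2 ^ 𝔫 + 1) % 2 ^ (κ + 1 + (𝔪 + 1)) * 2 ^ 𝔫 + Y % 2 ^ 𝔫) := by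
  have h : 𝔫 + (κ + 1 + (𝔪 + 1)) ≤ numSys 𝔪 κ 𝔫 := by unfold numSys; omega
  set Z := (Y / 2 ^ 𝔫 + 1) % 2 ^ (κ + 1 + (𝔪 + 1)) * 2 ^ 𝔫 + Y % 2 ^ 𝔫 with hZ
  have hmod : Y % 2 ^ 𝔫 = Z % 2 ^ 𝔫 := by
    rw [hZ, Nat.mul_add_mod', Nat.mod_mod]
  have hdiv : Z / 2 ^ 𝔫 = (Y / 2 ^ 𝔫 + 1) % 2 ^ (κ + 1 + (𝔪 + 1)) := by
    rw [hZ, mul_comm, Nat.mul_add_div (by positivity), Nat.div_eq_of_lt (Nat.mod_lt _ (by positivity)),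
      add_zero]
  funext q
  by_cases hq : q ∈ (padeLayout 𝔪 κ 𝔫 𝔡).blockBits
  · refine eq_of_bitVal_eq ?_ q hq
    rw [bitVal_incr (padeLayout 𝔪 κ 𝔫 𝔡).nodup_blockBits, padeLayout_blockBits,
      bitVal_basisState u Y h, bitVal_basisState u Z h, length_sysQs, hdiv, Nat.mod_add_mod,
      Nat.mod_mod]
  · rw [incr_of_notMem hq]
    rw [padeLayout_blockBits, mem_sysQs h] at hq
    rcases q with a | i
    · rfl
    · refine (agree_inner_iff u Y Z).2 hmod i ?_
      by_contra hi
      refine hq ⟨i, rfl, by omega, ?_⟩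
      have := i.2
      unfold numSys at this
      omega

lemma permOp_incr_apply {X Y : ℕ} (hX : X < 2 ^ numSys 𝔪 κ 𝔫) :
    permOp (incr (padeLayout 𝔪 κ 𝔫 𝔡).blockBits) (basisState u X) (basisState u Y) =
      if X / 2 ^ 𝔫 = (Y / 2 ^ 𝔫 + 1) % 2 ^ (κ + 1 + (𝔪 + 1)) ∧ X % 2 ^ 𝔫 = Y % 2 ^ 𝔫
        then 1 else 0 := by
  simp only [permOp, Matrix.of_apply, incr_basisState]
  congr 1
  rw [eq_iff_iff]
  set t := (Y / 2 ^ 𝔫 + 1) % 2 ^ (κ + 1 + (𝔪 + 1)) with ht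
  have htlt : t < 2 ^ (κ + 1 + (𝔪 + 1)) := Nat.mod_lt _ (by positivity)
  have hi : Y % 2 ^ 𝔫 < 2 ^ 𝔫 := Nat.mod_lt _ (by positivity)
  have hZ : t * 2 ^ 𝔫 + Y % 2 ^ 𝔫 < 2 ^ numSys 𝔪 κ 𝔫 := by
    have e : 2 ^ numSys 𝔪 κ 𝔫 = 2 ^ (κ + 1 + (𝔪 + 1)) * 2 ^ 𝔫 := by
      rw [← pow_add]; congr 1; unfold numSys; omega
    rw [e]
    calc t * 2 ^ 𝔫 + Y % 2 ^ 𝔫 < t * 2 ^ 𝔫 + 2 ^ 𝔫 := by omega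
      _ = (t + 1) * 2 ^ 𝔫 := by ring
      _ ≤ _ := Nat.mul_le_mul_right _ htlt
  constructor
  · intro h
    rw [basisState_injective u hX hZ h]
    constructor
    · rw [mul_comm, Nat.mul_add_div (by positivity), Nat.div_eq_of_lt hi, add_zero]
    · rw [Nat.mul_add_mod', Nat.mod_mod]
  · rintro ⟨h1, h2⟩
    rw [← h1, ← h2, Nat.div_add_mod']

/-- Row `X` of the product is the row one block earlier; `2 ^ 𝔫 ≤ X` excludes the wrap-around. -/
lemma permOp_incr_mul_apply {X : ℕ} (hX : X < 2 ^ numSys 𝔪 κ 𝔫) (h1 : 2 ^ 𝔫 ≤ X)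
    (M : QubitOp (Fin (𝔡 + 5) ⊕ Fin (numSys 𝔪 κ 𝔫))) (y : Fin (𝔡 + 5) ⊕ Fin (numSys 𝔪 κ 𝔫) → Fin 2) :
    (permOp (incr (padeLayout 𝔪 κ 𝔫 𝔡).blockBits) * M) (basisState u X) y =
      M (basisState u (X - 2 ^ 𝔫)) y := by
  have hn : 0 < 2 ^ 𝔫 := by positivity
  have hX' : (X - 2 ^ 𝔫) / 2 ^ 𝔫 + 1 = X / 2 ^ 𝔫 := by
    rw [← Nat.add_div_right _ hn, Nat.sub_add_cancel h1]
  have e : incr (padeLayout 𝔪 κ 𝔫 𝔡).blockBits (basisState u (X - 2 ^ 𝔫)) = basisState u X := by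
    rw [incr_basisState, hX', Nat.mod_eq_of_lt (div_lt_of_lt_numSys hX), ← Nat.mod_eq_sub_mod h1,
      Nat.div_add_mod']
  rw [Matrix.mul_apply, Finset.sum_eq_single (basisState u (X - 2 ^ 𝔫))]
  · simp [permOp, e]
  · intro z _ hz
    have : basisState u X ≠ incr (padeLayout 𝔪 κ 𝔫 𝔡).blockBits z := fun h =>
      hz (incr_injective (padeLayout 𝔪 κ 𝔫 𝔡).nodup_blockBits (h.symm.trans e.symm))
    simp [permOp, this]
  · simp

/-- The basis states of the qubits of the oracle. -/
def innerState (𝔡 𝔫 X : ℕ) : Fin 𝔡 ⊕ Fin 𝔫 → Fin 2 :=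
  Sum.elim (fun _ => 0) fun i => ⟨X / 2 ^ i.val % 2, Nat.mod_lt _ two_pos⟩

lemma embedOp_basisState (hu : ∀ i : Fin 𝔡, u (Fin.castAdd 5 i) = 0)
    (V : QubitOp (Fin 𝔡 ⊕ Fin 𝔫)) {X Y : ℕ} (hX : X < 2 ^ numSys 𝔪 κ 𝔫)
    (hY : Y < 2 ^ numSys 𝔪 κ 𝔫) :
    embedOp (padeLayout 𝔪 κ 𝔫 𝔡).w V (basisState u X) (basisState u Y) =
      if X / 2 ^ 𝔫 = Y / 2 ^ 𝔫 then V (innerState 𝔡 𝔫 X) (innerState 𝔡 𝔫 Y) else 0 := by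
  have hw : ∀ Z : ℕ, basisState u Z ∘ (padeLayout 𝔪 κ 𝔫 𝔡).w = innerState 𝔡 𝔫 Z := fun Z => by
    funext i
    rcases i with i | i
    · exact hu i
    · rfl
  have h : 𝔫 + (κ + 1 + (𝔪 + 1)) = numSys 𝔪 κ 𝔫 := by unfold numSys; omega
  simp only [embedOp, Matrix.of_apply, hw]
  congr 1
  rw [eq_iff_iff, ← agree_outer_iff u X Y _ _ h hX hY]
  constructor
  · intro H i hi
    refine H _ fun j hj => ?_
    rcases j with j | j
    · simp [padeLayout, oracleEmb] at hj
    · simp [padeLayout, oracleEmb, Fin.ext_iff] at hj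
      omega
  · intro H q hq
    rcases q with a | i
    · rfl
    · refine H i ?_
      by_contra hi
      exact hq (.inr ⟨i, by omega⟩) rfl

lemma basisState_top {X : ℕ} (hX : X < 2 ^ numSys 𝔪 κ 𝔫) :
    basisState u X (padeLayout 𝔪 κ 𝔫 𝔡).top =
      if X / 2 ^ 𝔫 < 2 ^ 𝔪 * 2 ^ (κ + 1) then 0 else 1 := by
  have hlt := div_lt_of_lt_numSys hX
  have h := basisState_sysQ (s := numSys 𝔪 κ 𝔫) u X (i := 𝔫 + (κ + 1) + 𝔪) (by unfold numSys; omega)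
  rw [add_assoc, pow_add, ← Nat.div_div_eq_div_mul, ← add_assoc, pow_add, mul_comm (2 ^ (κ + 1))] at h
  have e : 2 ^ (κ + 1 + (𝔪 + 1)) = 2 * (2 ^ 𝔪 * 2 ^ (κ + 1)) := by ring
  rw [e] at hlt
  apply Fin.ext
  refine h.trans ?_
  split_ifs with hc
  · rw [Nat.div_eq_of_lt hc]; rfl
  · have : X / 2 ^ 𝔫 / (2 ^ 𝔪 * 2 ^ (κ + 1)) = 1 := by
      rw [Nat.div_eq_iff (by positivity)]
      constructor <;> omega
    rw [this]; rfl

lemma matches_high_iff (X : ℕ) :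
    Matches ((padeLayout 𝔪 κ 𝔫 𝔡).high.map fun q => (q, 0)) (basisState u X) ↔
      X / 2 ^ 𝔫 / 2 ^ (κ + 1) % 2 ^ 𝔪 = 0 := by
  have h : 𝔫 + (κ + 1) + 𝔪 ≤ numSys 𝔪 κ 𝔫 := by unfold numSys; omega
  have h0 := basisState_eq_iff u X 0 h
  rw [Nat.zero_div, Nat.zero_mod, pow_add, ← Nat.div_div_eq_div_mul] at h0
  rw [← h0]
  simp only [Matches, List.forall_mem_map]
  refine forall₂_congr fun q hq => ?_
  obtain ⟨i, rfl, -⟩ := (mem_sysQs h).1 hq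
  have : (basisState u 0 : _ → Fin 2) (.inr i) = 0 := by
    apply Fin.ext
    simp [basisState]
  rw [this]

lemma coeff_basisState (c : Fin 2 → Fin 2 → Fin 2 → Bool → ℕ → ℝ) {X : ℕ}
    (hX : X < 2 ^ numSys 𝔪 κ 𝔫) :
    (padeLayout 𝔪 κ 𝔫 𝔡).coeff c (basisState u X) =
      c (u (Fin.natAdd 𝔡 0)) (u (Fin.natAdd 𝔡 1))
        (if X / 2 ^ 𝔫 < 2 ^ 𝔪 * 2 ^ (κ + 1) then 0 else 1)
        (decide (X / 2 ^ 𝔫 / 2 ^ (κ + 1) % 2 ^ 𝔪 = 0)) (X / 2 ^ 𝔫 % 2 ^ (κ + 1)) := by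
  have h : 𝔫 + (κ + 1) ≤ numSys 𝔪 κ 𝔫 := by unfold numSys; omega
  rw [Layout.coeff, basisState_top u hX, padeLayout_lows, bitVal_basisState u X h]
  simp only [matches_high_iff]
  rfl

/-! ### Entries of the rotations -/

lemma ry_neg_pi_div_four : ry (-(Real.pi / 4)) = !![((√2 / 2 : ℝ) : ℂ), ((√2 / 2 : ℝ) : ℂ);
    -((√2 / 2 : ℝ) : ℂ), ((√2 / 2 : ℝ) : ℂ)] := by
  rw [ry, Real.cos_neg, Real.sin_neg, Real.cos_pi_div_four, Real.sin_pi_div_four]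
  simp

lemma ry_pi_div_four : ry (Real.pi / 4) = !![((√2 / 2 : ℝ) : ℂ), -((√2 / 2 : ℝ) : ℂ);
    ((√2 / 2 : ℝ) : ℂ), ((√2 / 2 : ℝ) : ℂ)] := by
  rw [ry, Real.cos_pi_div_four, Real.sin_pi_div_four]

lemma sqrt_two_div_two_pow (l : ℕ) : (((√2 / 2 : ℝ) : ℂ)) ^ l = ((1 / √(2 ^ l : ℝ) : ℝ) : ℂ) := by
  rw [← Complex.ofReal_pow]
  congr 1
  rw [Real.sqrt_div_self', one_div, inv_pow, one_div, Real.sqrt_eq_rpow, Real.sqrt_eq_rpow,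
    ← Real.rpow_natCast, ← Real.rpow_natCast, ← Real.rpow_mul (by norm_num),
    ← Real.rpow_mul (by norm_num), mul_comm]

lemma agree_off_lows_iff {X Y : ℕ} (hX : X < 2 ^ numSys 𝔪 κ 𝔫) (hY : Y < 2 ^ numSys 𝔪 κ 𝔫) :
    (∀ q ∉ (padeLayout 𝔪 κ 𝔫 𝔡).lows, basisState u X q = basisState u Y q) ↔
      X % 2 ^ 𝔫 = Y % 2 ^ 𝔫 ∧ X / 2 ^ 𝔫 / 2 ^ (κ + 1) = Y / 2 ^ 𝔫 / 2 ^ (κ + 1) := by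
  have h : 𝔫 + (κ + 1) ≤ numSys 𝔪 κ 𝔫 := by unfold numSys; omega
  have h' : 𝔫 + (κ + 1) + (𝔪 + 1) = numSys 𝔪 κ 𝔫 := by unfold numSys; omega
  have h1 := agree_inner_iff (𝔪 := 𝔪) (κ := κ) (𝔫 := 𝔫) u X Y
  have h2 := agree_outer_iff u X Y _ _ h' hX hY
  rw [pow_add, ← Nat.div_div_eq_div_mul, ← Nat.div_div_eq_div_mul] at h2
  rw [← h1, ← h2]
  simp only [padeLayout_lows, mem_sysQs h]
  constructor
  · intro H
    constructor
    · intro i hi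
      refine H _ ?_
      rintro ⟨j, hj, h1, h2⟩
      cases hj
      omega
    · intro i hi
      refine H _ ?_
      rintro ⟨j, hj, h1, h2⟩
      cases hj
      omega
  · rintro ⟨H1, H2⟩ q hq
    rcases q with a | i
    · rfl
    · by_cases hi : i.val < 𝔫
      · exact H1 i hi
      · refine H2 i ?_
        by_contra hi'
        exact hq ⟨i, rfl, by omega, by omega⟩

lemma rot_basisState_of_le (j : Fin 2) {X Y : ℕ} (hX : X < 2 ^ numSys 𝔪 κ 𝔫)
    (hY : Y < 2 ^ numSys 𝔪 κ 𝔫) (ht : 2 ^ 𝔪 * 2 ^ (κ + 1) ≤ Y / 2 ^ 𝔫) :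
    (padeLayout 𝔪 κ 𝔫 𝔡).rot j (basisState u X) (basisState u Y) = if X = Y then 1 else 0 := by
  have h1 : ((padeLayout 𝔪 κ 𝔫 𝔡).lows.map fun b =>
      mux b fun _ => (1 : Matrix (Fin 2) (Fin 2) ℂ)).prod = 1 := by
    refine List.prod_eq_one fun M hM => ?_
    obtain ⟨b, -, rfl⟩ := List.mem_map.1 hM
    exact mux_one b
  have h2 : (padeLayout 𝔪 κ 𝔫 𝔡).rot j (basisState u X) (basisState u Y) =
      (1 : QubitOp (Fin (𝔡 + 5) ⊕ Fin (numSys 𝔪 κ 𝔫))) (basisState u X) (basisState u Y) := by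
    rw [← h1, Layout.rot_apply, prod_mux_apply (padeLayout 𝔪 κ 𝔫 𝔡).nodup_lows
      (List.Subset.refl _) (fun _ _ _ _ _ => rfl)]
    simp only [basisState_top u hY, if_neg (not_lt.2 ht), Layout.angle, one_ne_zero, if_false,
      ry_zero]
  rw [h2, Matrix.one_apply]
  congr 1
  rw [eq_iff_iff]
  exact ⟨basisState_injective u hX hY, fun h => by rw [h]⟩

/-- In the first row of a group all low digits are `0`, and both entries in the first row of `ry
(-π/4)` are `√2/2`. -/
lemma rot_zero_basisState {X Y : ℕ} (hX : X < 2 ^ numSys 𝔪 κ 𝔫) (hY : Y < 2 ^ numSys 𝔪 κ 𝔫)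
    (ht : Y / 2 ^ 𝔫 < 2 ^ 𝔪 * 2 ^ (κ + 1)) (hr : X / 2 ^ 𝔫 % 2 ^ (κ + 1) = 0) :
    (padeLayout 𝔪 κ 𝔫 𝔡).rot 0 (basisState u X) (basisState u Y) =
      if X % 2 ^ 𝔫 = Y % 2 ^ 𝔫 ∧ X / 2 ^ 𝔫 / 2 ^ (κ + 1) = Y / 2 ^ 𝔫 / 2 ^ (κ + 1) then
        ((1 / √(2 ^ (κ + 1) : ℝ) : ℝ) : ℂ) else 0 := by
  have h : 𝔫 + (κ + 1) ≤ numSys 𝔪 κ 𝔫 := by unfold numSys; omega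
  rw [Layout.rot_apply]
  simp only [agree_off_lows_iff u hX hY]
  split_ifs
  · have hz : ∀ q ∈ (padeLayout 𝔪 κ 𝔫 𝔡).lows, basisState u X q = 0 := by
      rw [padeLayout_lows]
      intro q hq
      have h0 := (basisState_eq_iff u X 0 h).2 (by rw [hr]; simp) q hq
      rw [h0]
      obtain ⟨i, rfl, -⟩ := (mem_sysQs h).1 hq
      apply Fin.ext
      simp [basisState]
    rw [List.prod_eq_pow_card _ (((√2 / 2 : ℝ) : ℂ)), List.length_map, padeLayout_lows,
      length_sysQs, sqrt_two_div_two_pow]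
    intro a ha
    obtain ⟨b, hb, rfl⟩ := List.mem_map.1 ha
    rw [hz b hb, basisState_top u hY, if_pos ht, Layout.angle, if_pos rfl, if_pos (Or.inl rfl),
      ry_neg_pi_div_four]
    generalize basisState u Y b = v
    fin_cases v <;> rfl
  · rfl

/-- In the last row of a group all low digits are `1`. The second row of `ry (π/4)` is constant,
that of `ry (-π/4)` changes sign; as only `low₀` is turned by `-π/4`, the sign depends on the parity
of the column block alone. -/
lemma rot_one_basisState {X Y : ℕ} (hX : X < 2 ^ numSys 𝔪 κ 𝔫) (hY : Y < 2 ^ numSys 𝔪 κ 𝔫)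
    (ht : Y / 2 ^ 𝔫 < 2 ^ 𝔪 * 2 ^ (κ + 1))
    (hr : X / 2 ^ 𝔫 % 2 ^ (κ + 1) = 2 ^ (κ + 1) - 1) :
    (padeLayout 𝔪 κ 𝔫 𝔡).rot 1 (basisState u X) (basisState u Y) =
      if X % 2 ^ 𝔫 = Y % 2 ^ 𝔫 ∧ X / 2 ^ 𝔫 / 2 ^ (κ + 1) = Y / 2 ^ 𝔫 / 2 ^ (κ + 1) then
        -((-1) ^ (Y / 2 ^ 𝔫) * ((1 / √(2 ^ (κ + 1) : ℝ) : ℝ) : ℂ)) else 0 := by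
  have h : 𝔫 + (κ + 1) ≤ numSys 𝔪 κ 𝔫 := by unfold numSys; omega
  rw [Layout.rot_apply]
  simp only [agree_off_lows_iff u hX hY]
  split_ifs
  · have hone : ∀ l : List (Fin (𝔡 + 5) ⊕ Fin (numSys 𝔪 κ 𝔫)),
        bitVal (fun _ => 1) l = 2 ^ l.length - 1 := fun l => by
      induction l with
      | nil => rfl
      | cons b l ih =>
        have := Nat.one_le_two_pow (n := l.length)
        rw [bitVal, ih, List.length_cons, pow_succ]
        change 1 + _ = _
        omega
    have hz : ∀ q ∈ (padeLayout 𝔪 κ 𝔫 𝔡).lows, basisState u X q = 1 := by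
      intro q hq
      refine eq_of_bitVal_eq (z := fun _ => 1) ?_ q hq
      rw [hone, padeLayout_lows, bitVal_basisState u X h, hr, length_sysQs]
    have hnd := (padeLayout 𝔪 κ 𝔫 𝔡).nodup_lows
    rw [Layout.lows, List.nodup_cons] at hnd
    simp only [Layout.lows, List.map_cons, List.prod_cons]
    rw [List.prod_eq_pow_card _ (((√2 / 2 : ℝ) : ℂ)), List.length_map,
      show (padeLayout 𝔪 κ 𝔫 𝔡).low.length = κ from length_sysQs _ _ _ _]
    · rw [hz _ (by simp [Layout.lows]), basisState_top u hY, if_pos ht, Layout.angle, if_pos rfl,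
        if_pos (Or.inr rfl), ry_neg_pi_div_four, ← sqrt_two_div_two_pow, pow_succ']
      -- The digit at `low₀` is the parity of the block number.
      have hv := basisState_sysQ (s := numSys 𝔪 κ 𝔫) u Y (i := 𝔫) (by unfold numSys; omega)
      change (basisState u Y (padeLayout 𝔪 κ 𝔫 𝔡).low₀).val = _ at hv
      rw [← Nat.div_add_mod (Y / 2 ^ 𝔫) 2, ← hv, pow_add, pow_mul]
      generalize basisState u Y (padeLayout 𝔪 κ 𝔫 𝔡).low₀ = v
      fin_cases v <;> simp
    · intro a ha
      obtain ⟨b, hb, rfl⟩ := List.mem_map.1 ha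
      have hb0 : b ≠ (padeLayout 𝔪 κ 𝔫 𝔡).low₀ := fun h => hnd.1 (by rw [← h]; exact hb)
      rw [hz b (by simp [Layout.lows, hb]), basisState_top u hY, if_pos ht, Layout.angle,
        if_pos rfl, if_neg (by simp [hb0]), ry_pi_div_four]
      generalize basisState u Y b = v
      fin_cases v <;> rfl
  · rfl

end Layout

/-! ### The encoded matrix, by numbers of blocks -/

section Matrix

/-- The part of `L_{m,k,p}` with the uniform rows and the diagonal of the second half. -/
noncomputable def uniformPart (m k t t' : ℕ) : ℂ :=
  if t < m * (k + 1) then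
    if t % (k + 1) = 0 ∧ t / (k + 1) = t' / (k + 1) then ((1 / √((k : ℝ) + 1) : ℝ) : ℂ) else 0
  else if t = t' then (if t = m * (k + 1) then ((1 / √((k : ℝ) + 1) : ℝ) : ℂ) else 1) else 0

/-- The part of `L_{m,k,p}` with the identities below the diagonal. -/
noncomputable def shiftPart (m k t t' : ℕ) : ℂ :=
  if t = t' + 1 then
    if t < m * (k + 1) then (if t % (k + 1) = 0 then 0 else 1)
    else if t = m * (k + 1) then 0 else -1
  else 0

/-- The part of `L_{m,k,p}` with the rows of alternating signs. -/
noncomputable def signPart (m k t t' : ℕ) : ℂ :=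
  if t % (k + 1) = 0 ∧ 0 < t ∧ t ≤ m * (k + 1) ∧ t' / (k + 1) + 1 = t / (k + 1) then
    (-1) ^ t' * ((1 / √((k : ℝ) + 1) : ℝ) : ℂ) else 0

/-- The coefficients of the encoded matrix in `L_{m,k,p}`. -/
noncomputable def diagPart (m k t t' : ℕ) : ℂ :=
  if t = t' ∧ t < m * (k + 1) ∧ t % (k + 1) ≠ 0 then
    ((padeBeta k (k + 1 - t % (k + 1)) : ℝ) : ℂ) else 0

/-- The number of a block. -/
def blockNum (m k p : ℕ) : (Fin m × Fin (k + 1)) ⊕ Fin p → ℕ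
  | .inl (s, r) => s.val * (k + 1) + r.val
  | .inr a => m * (k + 1) + a.val

lemma padeLIndex_val (m k p n : ℕ) (B : (Fin m × Fin (k + 1)) ⊕ Fin p) (i : Fin n) :
    (padeLIndex m k p n (B, i)).val = blockNum m k p B * n + i.val := by
  rcases B with ⟨s, r⟩ | a
  · simp [padeLIndex, blockNum]; ring
  · simp [padeLIndex, blockNum]; ring

lemma padeLBlock_apply {n m k p : ℕ} (hk : Even (k + 1))
    (A : Matrix (Fin n) (Fin n) ℂ) (B B' : (Fin m × Fin (k + 1)) ⊕ Fin p) (i i' : Fin n) :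
    padeLBlock m k p A B B' i i' =
      diagPart m k (blockNum m k p B) (blockNum m k p B') * A i i' +
        if i = i' then uniformPart m k (blockNum m k p B) (blockNum m k p B') +
          shiftPart m k (blockNum m k p B) (blockNum m k p B') +
          signPart m k (blockNum m k p B) (blockNum m k p B') else 0 := by
  have hK : 0 < k + 1 := k.succ_pos
  have hdiv : ∀ s r : ℕ, r < k + 1 → (s * (k + 1) + r) / (k + 1) = s := fun s r hr => by
    rw [mul_comm, Nat.mul_add_div hK, Nat.div_eq_of_lt hr, add_zero]
  have hmod : ∀ s r : ℕ, r < k + 1 → (s * (k + 1) + r) % (k + 1) = r := fun s r hr => by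
    rw [Nat.mul_add_mod', Nat.mod_eq_of_lt hr]
  have hlt : ∀ s r : ℕ, s < m → r < k + 1 → s * (k + 1) + r < m * (k + 1) := fun s r hs hr =>
    calc s * (k + 1) + r < s * (k + 1) + (k + 1) := by omega
      _ = (s + 1) * (k + 1) := by ring
      _ ≤ m * (k + 1) := Nat.mul_le_mul_right _ hs
  have hinj : ∀ s r t c : ℕ, r < k + 1 → c < k + 1 →
      (s * (k + 1) + r = t * (k + 1) + c ↔ s = t ∧ r = c) := fun s r t c hr hc => by
    refine ⟨fun h => ?_, fun h => by rw [h.1, h.2]⟩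
    have h1 := congrArg (· / (k + 1)) h
    have h2 := congrArg (· % (k + 1)) h
    simp only [hdiv _ _ hr, hdiv _ _ hc, hmod _ _ hr, hmod _ _ hc] at h1 h2
    exact ⟨h1, h2⟩
  -- As `k + 1` is even, the sign in `padeSign` is the parity of the number of the block in the
  -- whole matrix.
  have hsign : ∀ t c : ℕ, c < k + 1 → (-1 : ℂ) ^ (t * (k + 1) + c) = (-1) ^ (k + 1 - c) :=
    fun t c hc => by
      have h1 : (-1 : ℂ) ^ (t * (k + 1)) = 1 := (hk.mul_left t).neg_one_pow
      have h2 : (-1 : ℂ) ^ (k + 1 - c) * (-1) ^ c = 1 := by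
        rw [← pow_add, Nat.sub_add_cancel hc.le, hk.neg_one_pow]
      have h3 : (-1 : ℂ) ^ c * (-1) ^ c = 1 := by rw [← mul_pow]; simp
      rw [pow_add, h1, one_mul]
      linear_combination (-1 : ℂ) ^ (k + 1 - c) * h3 - (-1 : ℂ) ^ c * h2
  have hz : ∀ (r : ℕ) (hr : r < k + 1), (⟨r, hr⟩ : Fin (k + 1)) = 0 ↔ r = 0 := fun r hr => by
    simp [Fin.ext_iff]
  rcases B with ⟨⟨s, hs⟩, ⟨r, hr⟩⟩ | ⟨a, ha⟩ <;> rcases B' with ⟨⟨t, ht⟩, ⟨c, hc⟩⟩ | ⟨b, hb⟩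
  · simp only [padeLBlock, padeW, padeSign, blockNum, diagPart, uniformPart, shiftPart, signPart,
      hdiv _ _ hr, hdiv _ _ hc, hmod _ _ hr, hlt _ _ hs hr, hinj _ _ _ _ hr hc, hsign _ _ hc,
      (hlt _ _ hs hr).le, if_true, true_and, Fin.mk.injEq, hz]
    have h2 : r ≠ 0 → (s * (k + 1) + r = t * (k + 1) + c + 1 ↔ s = t ∧ c + 1 = r) := fun h => by
      have := hinj s (r - 1) t c (by omega) hc
      omega
    by_cases hst : s = t
    · subst hst
      by_cases h0 : r = 0
      · subst h0
        by_cases hi : i = i' <;> simp [hi]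
      · by_cases hcr : c + 1 = r
        · have : ¬ r = c := by omega
          by_cases hi : i = i' <;> simp [h2 h0, h0, hcr, this, hi, Matrix.one_apply]
        · by_cases hc' : r = c
          · subst hc'
            by_cases hi : i = i' <;> simp [h0, hi]
          · simp [h2 h0, h0, hcr, hc', Ne.symm hc']
    · by_cases h0 : r = 0
      · subst h0
        by_cases hts : t + 1 = s
        · have : 0 < s := by omega
          by_cases hi : i = i' <;> simp [hst, hts, hi, this]
        · simp [hst, hts]
      · simp [hst, h0, h2 h0]
  · have h1 := hlt s r hs hr
    have h2 : s ≠ (m * (k + 1) + b) / (k + 1) := fun h => by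
      have := (Nat.le_div_iff_mul_le hK (x := m)).2 (Nat.le_add_right (m * (k + 1)) b)
      omega
    have h3 : ¬ s * (k + 1) + r = m * (k + 1) + b := by omega
    have h4 : ¬ s * (k + 1) + r = m * (k + 1) + b + 1 := by omega
    have h5 : ¬ (m * (k + 1) + b) / (k + 1) + 1 = s := by
      have := (Nat.le_div_iff_mul_le hK (x := m)).2 (Nat.le_add_right (m * (k + 1)) b)
      omega
    simp only [padeLBlock, blockNum, diagPart, uniformPart, shiftPart, signPart, hdiv _ _ hr, h1, h2,
      h3, h4, h5, if_true, if_false, and_false, false_and, Matrix.zero_apply]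
    simp
  · have h1 := hlt t c ht hc
    have h2 : ¬ m * (k + 1) + a < m * (k + 1) := by omega
    have h3 : ¬ m * (k + 1) + a = t * (k + 1) + c := by omega
    have h4 : (m * (k + 1) + a) % (k + 1) = 0 ∧ 0 < m * (k + 1) + a ∧
        m * (k + 1) + a ≤ m * (k + 1) ∧ t + 1 = (m * (k + 1) + a) / (k + 1) ↔
        a = 0 ∧ t + 1 = m := by
      constructor
      · rintro ⟨-, -, h, h'⟩
        have : a = 0 := by omega
        subst this
        exact ⟨rfl, by rw [h', hdiv _ _ hK]⟩
      · rintro ⟨rfl, h⟩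
        rw [hdiv _ _ hK, hmod _ _ hK]
        exact ⟨rfl, by omega, by omega, h⟩
    have h5 : m * (k + 1) + a = t * (k + 1) + c + 1 → a = 0 := by omega
    simp only [padeLBlock, padeSign, blockNum, diagPart, uniformPart, shiftPart, signPart,
      hdiv _ _ hc, h2, h3, h4, hsign _ _ hc, if_false, false_and]
    by_cases ha : a = 0 ∧ t + 1 = m
    · by_cases hi : i = i' <;> simp [ha, hi]
    · by_cases h6 : m * (k + 1) + a = t * (k + 1) + c + 1
      · have : ¬ t + 1 = m := fun h => ha ⟨h5 h6, h⟩
        simp [h5 h6, this]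
      · simp [ha, h6]
  · have h1 : ¬ m * (k + 1) + a < m * (k + 1) := by omega
    have h2 : ¬ ((m * (k + 1) + a) % (k + 1) = 0 ∧ 0 < m * (k + 1) + a ∧
        m * (k + 1) + a ≤ m * (k + 1) ∧
        (m * (k + 1) + b) / (k + 1) + 1 = (m * (k + 1) + a) / (k + 1)) := by
      rintro ⟨-, -, h, h'⟩
      have : a = 0 := by omega
      subst this
      rw [hdiv _ _ hK] at h'
      have := (Nat.le_div_iff_mul_le hK (x := m)).2 (Nat.le_add_right (m * (k + 1)) b)
      omega
    have h3 : m * (k + 1) + a = m * (k + 1) + b ↔ a = b := by omega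
    have h4 : m * (k + 1) + a = m * (k + 1) + b + 1 ↔ b + 1 = a := by omega
    have h5 : m * (k + 1) + a = m * (k + 1) ↔ a = 0 := by omega
    simp only [padeLBlock, blockNum, diagPart, uniformPart, shiftPart, signPart, h1, h2, h3, h4, h5,
      Fin.mk.injEq, if_false, false_and, and_false]
    by_cases hab : a = b
    · subst hab
      by_cases h0 : a = 0 <;> by_cases hi : i = i' <;> simp [h0, hi, Matrix.one_apply]
    · by_cases hba : b + 1 = a
      · have h0 : a ≠ 0 := by omega
        by_cases hi : i = i' <;> simp [hab, hba, h0, hi]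
      · simp [hab, hba]

/-! ### The coefficients of the circuit -/

/-- The coefficients produced by the rotation of the qubit `f`. -/
noncomputable def padeCoeff (M w : ℝ) (k : ℕ) (a b t : Fin 2) (z : Bool) (r : ℕ) : ℝ :=
  (if a = 0 then
    if b = 0 then (if t = 0 ∧ r ≠ 0 then w * padeBeta k (k + 1 - r) else 0)
    else if t = 0 then (if r = 0 then 0 else 1) else (if r = 0 ∧ z = true then 0 else -1)
  else if b = 0 then
    if t = 0 then (if r = 0 then 1 else 0)
    else (if r = 0 ∧ z = true then 1 / √((k : ℝ) + 1) else 1)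
  else if r = 0 ∧ (t = 0 ↔ z = false) then -1 else 0) / M

lemma abs_padeBeta_le {k r : ℕ} (hr : r ≠ 0) : |padeBeta k (k + 1 - r)| ≤ 1 := by
  -- For `r > k` the truncated subtraction gives `padeBeta k 0`, which is `0` by division by zero.
  -- Otherwise the value is `r / ((k + 1 - r) (k + r))`, with first factor at least `1`.
  rcases Nat.lt_or_ge k r with h | h
  · rw [Nat.sub_eq_zero_of_le h]
    simp [padeBeta]
  · have e : ((k + 1 - r : ℕ) : ℝ) = (k : ℝ) + 1 - r := by
      rw [Nat.cast_sub (by omega)]; push_cast; ring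
    have h1 : (1 : ℝ) ≤ r := by exact_mod_cast Nat.one_le_iff_ne_zero.2 hr
    have h2 : (r : ℝ) ≤ k := by exact_mod_cast h
    rw [padeBeta, e]
    have hn : (k : ℝ) + 1 - ((k : ℝ) + 1 - r) = r := by ring
    have hd : 2 * (k : ℝ) + 1 - ((k : ℝ) + 1 - r) = k + r := by ring
    rw [hn, hd, abs_of_nonneg (by apply div_nonneg <;> nlinarith), div_le_one (by nlinarith)]
    nlinarith

/-- This is what makes `arccos` invert the cosine, and the reason for dividing by `M`: it must
dominate both `w = α h` and the coefficients `±1`. -/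
lemma abs_padeCoeff_le {M w : ℝ} (hM : 1 ≤ M) (hw : 0 ≤ w) (hwM : w ≤ M) (k : ℕ) (a b t : Fin 2)
    (z : Bool) (r : ℕ) : |padeCoeff M w k a b t z r| ≤ 1 := by
  have hM0 : 0 < M := by linarith
  have h1 : |1 / √((k : ℝ) + 1)| ≤ M := by
    rw [abs_of_nonneg (by positivity)]
    refine le_trans ?_ hM
    rw [div_le_one (by positivity), Real.one_le_sqrt]
    have : (0 : ℝ) ≤ k := k.cast_nonneg
    linarith
  rw [padeCoeff, abs_div, abs_of_pos hM0, div_le_one hM0]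
  split_ifs with _ _ h
  · rw [abs_mul, abs_of_nonneg hw]
    exact (mul_le_of_le_one_right hw (abs_padeBeta_le h.2)).trans hwM
  all_goals first
    | exact h1
    | simpa using hM
    | simpa using hM0.le

end Matrix

/-! ### The four operators of the circuit against the four parts of the matrix. -/

section Entries

variable {𝔪 κ 𝔫 𝔡 k : ℕ} {M w : ℝ} {u : Fin (𝔡 + 5) → Fin 2} {X Y : ℕ}

local notation "ℓ" => padeLayout 𝔪 κ 𝔫 𝔡

lemma coeff_mul_embedOp (hk : k + 1 = 2 ^ (κ + 1)) (hX : X < 2 ^ numSys 𝔪 κ 𝔫)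
    (hY : Y < 2 ^ numSys 𝔪 κ 𝔫) (hu : ∀ i : Fin 𝔡, u (Fin.castAdd 5 i) = 0)
    (h0 : u (Fin.natAdd 𝔡 0) = 0) (h1 : u (Fin.natAdd 𝔡 1) = 0) (V : QubitOp (Fin 𝔡 ⊕ Fin 𝔫)) :
    ((ℓ).coeff (padeCoeff M w k) (basisState u X) : ℂ) *
      embedOp (ℓ).w V (basisState u X) (basisState u Y) =
    w / M * (diagPart (2 ^ 𝔪) k (X / 2 ^ 𝔫) (Y / 2 ^ 𝔫) *
      V (innerState 𝔡 𝔫 X) (innerState 𝔡 𝔫 Y)) := by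
  rw [coeff_basisState u _ hX, embedOp_basisState u hu V hX hY, h0, h1, ← hk]
  simp only [padeCoeff, diagPart, if_true]
  by_cases ht : X / 2 ^ 𝔫 = Y / 2 ^ 𝔫
  · by_cases hlt : X / 2 ^ 𝔫 < 2 ^ 𝔪 * (k + 1)
    · by_cases hr : X / 2 ^ 𝔫 % (k + 1) = 0
      · simp [hr]
      · have hlt' := hlt
        have hr' := hr
        rw [ht] at hlt' hr'
        simp [hr', hlt', ht]
        ring
    · have hlt' := hlt
      rw [ht] at hlt'
      simp [hlt', ht]
  · simp [ht]

lemma eq_iff_div_mod (X Y : ℕ) :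
    X = Y ↔ X / 2 ^ 𝔫 = Y / 2 ^ 𝔫 ∧ X % 2 ^ 𝔫 = Y % 2 ^ 𝔫 := by
  refine ⟨fun h => by rw [h]; exact ⟨rfl, rfl⟩, fun h => ?_⟩
  rw [← Nat.div_add_mod X (2 ^ 𝔫), h.1, h.2, Nat.div_add_mod]

/-- In the second half, vanishing `lows` and `high` single out its first block row, the only
exceptional one there. -/
lemma eq_mul_iff {m K t : ℕ} (hK : 0 < K) (h1 : m * K ≤ t) (h2 : t < 2 * (m * K)) :
    t % K = 0 ∧ t / K % m = 0 ↔ t = m * K := by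
  have h3 : m ≤ t / K := (Nat.le_div_iff_mul_le hK).2 h1
  have h4 : t / K < 2 * m := (Nat.div_lt_iff_lt_mul hK).2 (by rw [mul_assoc]; exact h2)
  constructor
  · rintro ⟨h5, h6⟩
    rw [Nat.mod_eq_sub_mod h3, Nat.mod_eq_of_lt (by omega)] at h6
    rw [← Nat.div_add_mod t K, h5, show t / K = m by omega, add_zero, mul_comm]
  · rintro rfl
    rw [Nat.mul_mod_left, Nat.mul_div_cancel _ hK, Nat.mod_self]
    exact ⟨rfl, rfl⟩

lemma rot_eq_zero (j : Fin 2) (hX : X < 2 ^ numSys 𝔪 κ 𝔫) (hY : Y < 2 ^ numSys 𝔪 κ 𝔫)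
    (h : X / 2 ^ 𝔫 / 2 ^ (κ + 1) ≠ Y / 2 ^ 𝔫 / 2 ^ (κ + 1)) :
    (ℓ).rot j (basisState u X) (basisState u Y) = 0 := by
  rw [Layout.rot_apply]
  exact if_neg fun h' => h ((agree_off_lows_iff u hX hY).1 h').2

lemma div_lt_two_mul (hk : k + 1 = 2 ^ (κ + 1)) (hX : X < 2 ^ numSys 𝔪 κ 𝔫) :
    X / 2 ^ 𝔫 < 2 * (2 ^ 𝔪 * (k + 1)) := by
  refine (div_lt_of_lt_numSys hX).trans_eq ?_
  rw [hk]; ring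

lemma sqrt_pow_eq (hk : k + 1 = 2 ^ (κ + 1)) : √(2 ^ (κ + 1) : ℝ) = √((k : ℝ) + 1) := by
  congr 1
  exact_mod_cast hk.symm

/-- The rotations never join different groups, so blocks in different halves do not interact. In the
first half only first rows of groups have a nonzero coefficient; in the second half the rotations
are the identity. -/
lemma coeff_mul_rot_zero (hk : k + 1 = 2 ^ (κ + 1)) (hX : X < 2 ^ numSys 𝔪 κ 𝔫)
    (hY : Y < 2 ^ numSys 𝔪 κ 𝔫) (h0 : u (Fin.natAdd 𝔡 0) = 1) (h1 : u (Fin.natAdd 𝔡 1) = 0) :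
    ((ℓ).coeff (padeCoeff M w k) (basisState u X) : ℂ) *
      (ℓ).rot 0 (basisState u X) (basisState u Y) =
    1 / M * if X % 2 ^ 𝔫 = Y % 2 ^ 𝔫 then
      uniformPart (2 ^ 𝔪) k (X / 2 ^ 𝔫) (Y / 2 ^ 𝔫) else 0 := by
  have hK : 0 < k + 1 := k.succ_pos
  have hdX := div_lt_two_mul hk hX
  have e1 := rot_zero_basisState (𝔡 := 𝔡) u hX hY
  have e2 := rot_basisState_of_le (𝔡 := 𝔡) u 0 hX hY
  have e3 := rot_eq_zero (𝔡 := 𝔡) (u := u) 0 hX hY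
  rw [coeff_basisState u _ hX, h0, h1]
  rw [sqrt_pow_eq hk] at e1
  simp only [← hk, eq_iff_div_mod (𝔫 := 𝔫) X Y] at e1 e2 e3 ⊢
  simp only [padeCoeff, uniformPart, one_ne_zero, if_true, if_false]
  have hdm := eq_mul_iff hK (m := 2 ^ 𝔪) (t := X / 2 ^ 𝔫)
  generalize X / 2 ^ 𝔫 = t at *
  generalize Y / 2 ^ 𝔫 = t' at *
  have hlt : ∀ t, t < 2 ^ 𝔪 * (k + 1) ↔ t / (k + 1) < 2 ^ 𝔪 := fun t =>
    (Nat.div_lt_iff_lt_mul hK).symm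
  by_cases ht : t < 2 ^ 𝔪 * (k + 1) <;> by_cases ht' : t' < 2 ^ 𝔪 * (k + 1)
  · by_cases hr : t % (k + 1) = 0
    · rw [e1 ht' hr]
      by_cases hi : X % 2 ^ 𝔫 = Y % 2 ^ 𝔫 <;> simp [ht, hr, hi]
    · simp [ht, hr]
  · have hne : t / (k + 1) ≠ t' / (k + 1) := fun h => ht' ((hlt _).2 (h ▸ (hlt _).1 ht))
    rw [e3 hne]
    simp [ht, hne]
  · have hne : t / (k + 1) ≠ t' / (k + 1) := fun h => ht ((hlt _).2 (h ▸ (hlt _).1 ht'))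
    have hne' : t ≠ t' := fun h => hne (by rw [h])
    rw [e3 hne]
    simp [ht, hne']
  · rw [e2 (not_lt.1 ht')]
    have hdm' := hdm (not_lt.1 ht) hdX
    by_cases htt : t = t'
    · subst htt
      by_cases hm : t = 2 ^ 𝔪 * (k + 1)
      · have := hdm'.2 hm
        by_cases hi : X % 2 ^ 𝔫 = Y % 2 ^ 𝔫
        · simp only [if_neg ht, if_pos hm, hi, this, decide_true, and_self, if_true,
            one_ne_zero, if_false]
          push_cast; ring
        · simp [hi]
      · have : ¬ (t % (k + 1) = 0 ∧ decide (t / (k + 1) % 2 ^ 𝔪 = 0) = true) := by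
          rw [decide_eq_true_iff, hdm']; exact hm
        by_cases hi : X % 2 ^ 𝔫 = Y % 2 ^ 𝔫
        · simp only [if_neg ht, if_neg hm, hi, this, if_true, one_ne_zero, if_false,
            and_true]
          push_cast; ring
        · simp [hi]
    · simp [ht, htt]

lemma coeff_mul_permOp (hk : k + 1 = 2 ^ (κ + 1)) (hX : X < 2 ^ numSys 𝔪 κ 𝔫)
    (hY : Y < 2 ^ numSys 𝔪 κ 𝔫) (h0 : u (Fin.natAdd 𝔡 0) = 0) (h1 : u (Fin.natAdd 𝔡 1) = 1) :
    ((ℓ).coeff (padeCoeff M w k) (basisState u X) : ℂ) *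
      permOp (incr (ℓ).blockBits) (basisState u X) (basisState u Y) =
    1 / M * if X % 2 ^ 𝔫 = Y % 2 ^ 𝔫 then
      shiftPart (2 ^ 𝔪) k (X / 2 ^ 𝔫) (Y / 2 ^ 𝔫) else 0 := by
  have hK : 0 < k + 1 := k.succ_pos
  have hdX := div_lt_two_mul hk hX
  have hdY := div_lt_two_mul hk hY
  rw [coeff_basisState u _ hX, permOp_incr_apply u hX, h0, h1,
    show 2 ^ (κ + 1 + (𝔪 + 1)) = 2 * (2 ^ 𝔪 * (k + 1)) by rw [hk]; ring]
  simp only [← hk, padeCoeff, shiftPart, one_ne_zero, if_true, if_false]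
  have hdm := eq_mul_iff hK (m := 2 ^ 𝔪) (t := X / 2 ^ 𝔫)
  generalize X / 2 ^ 𝔫 = t at *
  generalize Y / 2 ^ 𝔫 = t' at *
  -- The wrap-around only reaches block `0`, where the coefficient is `0`.
  have hmod : t ≠ 0 → (t = (t' + 1) % (2 * (2 ^ 𝔪 * (k + 1))) ↔ t = t' + 1) := fun h => by
    rcases (Nat.succ_le_of_lt hdY).lt_or_eq with h' | h'
    · rw [Nat.mod_eq_of_lt h']
    · rw [show t' + 1 = 2 * (2 ^ 𝔪 * (k + 1)) from h', Nat.mod_self]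
      omega
  by_cases hi : X % 2 ^ 𝔫 = Y % 2 ^ 𝔫
  · by_cases ht : t < 2 ^ 𝔪 * (k + 1)
    · by_cases hr : t % (k + 1) = 0
      · simp [ht, hr]
      · have h0 : t ≠ 0 := fun h => hr (by rw [h, Nat.zero_mod])
        simp only [hmod h0, ht, hr, hi, if_true, if_false, and_true]
        split_ifs <;> simp
    · have hpos : 0 < 2 ^ 𝔪 * (k + 1) := by positivity
      have h0 : t ≠ 0 := by omega
      have hdm' := hdm (not_lt.1 ht) hdX
      by_cases hm : t = 2 ^ 𝔪 * (k + 1)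
      · have := hdm'.2 hm
        simp only [if_neg ht, if_pos hm, this, decide_true, and_self, if_true, one_ne_zero, if_false]
        simp
      · have : ¬ (t % (k + 1) = 0 ∧ decide (t / (k + 1) % 2 ^ 𝔪 = 0) = true) := by
          rw [decide_eq_true_iff, hdm']; exact hm
        simp only [hmod h0, if_neg ht, if_neg hm, this, hi, if_true, one_ne_zero, if_false, and_true]
        split_ifs
        · push_cast; ring
        · simp
  · simp [hi]

/-- The last row of each of the `m` groups is moved to the block that follows it, for the last group
the first block of the second half. The coefficient `-1` cancels the sign in `rot_one_basisState`.
-/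
lemma coeff_mul_permOp_rot_one (hk : k + 1 = 2 ^ (κ + 1)) (hX : X < 2 ^ numSys 𝔪 κ 𝔫)
    (hY : Y < 2 ^ numSys 𝔪 κ 𝔫) (h0 : u (Fin.natAdd 𝔡 0) = 1) (h1 : u (Fin.natAdd 𝔡 1) = 1) :
    ((ℓ).coeff (padeCoeff M w k) (basisState u X) : ℂ) *
      (permOp (incr (ℓ).blockBits) * (ℓ).rot 1) (basisState u X) (basisState u Y) =
    1 / M * if X % 2 ^ 𝔫 = Y % 2 ^ 𝔫 then
      signPart (2 ^ 𝔪) k (X / 2 ^ 𝔫) (Y / 2 ^ 𝔫) else 0 := by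
  have hK : 0 < k + 1 := k.succ_pos
  have hn : 0 < 2 ^ 𝔫 := by positivity
  have hdX := div_lt_two_mul hk hX
  have hcond : X / 2 ^ 𝔫 % (k + 1) = 0 → (((if X / 2 ^ 𝔫 < 2 ^ 𝔪 * (k + 1) then 0 else 1 : Fin 2) = 0 ↔
      decide (X / 2 ^ 𝔫 / (k + 1) % 2 ^ 𝔪 = 0) = false) ↔
      0 < X / 2 ^ 𝔫 ∧ X / 2 ^ 𝔫 ≤ 2 ^ 𝔪 * (k + 1)) := fun hr => by
    rw [decide_eq_false_iff_not]
    have hpos : 0 < 2 ^ 𝔪 * (k + 1) := by positivity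
    generalize X / 2 ^ 𝔫 = t at *
    by_cases ht : t < 2 ^ 𝔪 * (k + 1)
    · have h3 : t / (k + 1) < 2 ^ 𝔪 := (Nat.div_lt_iff_lt_mul hK).2 ht
      rw [Nat.mod_eq_of_lt h3]
      have : t / (k + 1) = 0 ↔ t = 0 := by
        constructor
        · intro h
          rw [← Nat.div_add_mod (t) (k + 1), h, hr, mul_zero]
        · intro h; rw [h, Nat.zero_div]
      simp only [ht, this, if_true, true_iff]
      omega
    · have hdm := eq_mul_iff hK (not_lt.1 ht) hdX
      simp only [hr, true_and] at hdm
      simp only [ht, hdm, if_false, one_ne_zero, false_iff, not_not]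
      omega
  rw [coeff_basisState u _ hX, h0, h1]
  simp only [← hk, padeCoeff, one_ne_zero, if_false]
  by_cases hS : X / 2 ^ 𝔫 % (k + 1) = 0 ∧ 0 < X / 2 ^ 𝔫 ∧ X / 2 ^ 𝔫 ≤ 2 ^ 𝔪 * (k + 1)
  · obtain ⟨hr, hpos, hle⟩ := hS
    have hnX : 2 ^ 𝔫 ≤ X := by
      by_contra h
      rw [Nat.div_eq_of_lt (not_le.1 h)] at hpos
      exact lt_irrefl _ hpos
    rw [if_pos ⟨hr, (hcond hr).2 ⟨hpos, hle⟩⟩, permOp_incr_mul_apply u hX hnX]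
    have hX' : X - 2 ^ 𝔫 < 2 ^ numSys 𝔪 κ 𝔫 := (Nat.sub_le _ _).trans_lt hX
    have hd : (X - 2 ^ 𝔫) / 2 ^ 𝔫 + 1 = X / 2 ^ 𝔫 := by
      rw [← Nat.add_div_right _ hn, Nat.sub_add_cancel hnX]
    have hm : (X - 2 ^ 𝔫) % 2 ^ 𝔫 = X % 2 ^ 𝔫 := (Nat.mod_eq_sub_mod hnX).symm
    have e1 := rot_one_basisState (𝔡 := 𝔡) u hX' hY
    have e3 := rot_eq_zero (𝔡 := 𝔡) (u := u) 1 hX' hY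
    rw [sqrt_pow_eq hk] at e1
    simp only [← hk, hm] at e1 e3
    generalize (X - 2 ^ 𝔫) / 2 ^ 𝔫 = t₁ at *
    generalize X / 2 ^ 𝔫 = t at *
    generalize Y / 2 ^ 𝔫 = t' at *
    -- The block before `(k + 1) (ρ + 1)` is the last one of group `ρ`, where `rot_one_basisState`
    -- applies.
    obtain ⟨σ, rfl⟩ := Nat.dvd_of_mod_eq_zero hr
    have hσ : 0 < σ := Nat.pos_of_mul_pos_left hpos
    obtain ⟨ρ, rfl⟩ : ∃ ρ, σ = ρ + 1 := ⟨σ - 1, by omega⟩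
    have ht₁ : t₁ = (k + 1) * ρ + k := by
      have : (k + 1) * (ρ + 1) = (k + 1) * ρ + (k + 1) := by ring
      omega
    have hdiv : t₁ / (k + 1) = ρ := by
      rw [ht₁, Nat.mul_add_div hK, Nat.div_eq_of_lt (Nat.lt_succ_self k), add_zero]
    have hmod : t₁ % (k + 1) = k + 1 - 1 := by
      rw [ht₁, Nat.mul_add_mod, Nat.mod_eq_of_lt (Nat.lt_succ_self k)]; rfl
    have hρ : ρ + 1 ≤ 2 ^ 𝔪 := by
      rw [mul_comm] at hle
      exact Nat.le_of_mul_le_mul_right hle hK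
    simp only [signPart, hr, hpos, hle, true_and, Nat.mul_div_cancel_left _ hK, add_left_inj]
    by_cases hρt : t' / (k + 1) = ρ
    · have ht' : t' < 2 ^ 𝔪 * (k + 1) := by
        rw [← Nat.div_lt_iff_lt_mul hK, hρt]; omega
      rw [e1 ht' hmod, hdiv]
      by_cases hi : X % 2 ^ 𝔫 = Y % 2 ^ 𝔫
      · simp [hi, hρt]
        ring
      · simp [hi]
    · rw [e3 (by rw [hdiv]; exact Ne.symm hρt)]
      simp [hρt]
  · have hS' : ¬ (X / 2 ^ 𝔫 % (k + 1) = 0 ∧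
        ((if X / 2 ^ 𝔫 < 2 ^ 𝔪 * (k + 1) then 0 else 1 : Fin 2) = 0 ↔
          decide (X / 2 ^ 𝔫 / (k + 1) % 2 ^ 𝔪 = 0) = false)) := fun h =>
      hS ⟨h.1, (hcond h.1).1 h.2⟩
    have hs : signPart (2 ^ 𝔪) k (X / 2 ^ 𝔫) (Y / 2 ^ 𝔫) = 0 :=
      if_neg fun h => hS ⟨h.1, h.2.1, h.2.2.1⟩
    rw [if_neg hS', hs]
    simp

end Entries

/-! ### The number of gates -/

/-- The constant is `1000 · 4 · 8`: from the size in terms of `κ + 𝔪 + 1`, from splitting off the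
`1` in the cube, and from passing to the logarithm. The additive constants are absorbed by `k ≥ 1`,
which matters when `m k = 1` and the logarithm vanishes. -/
lemma size_padeLayout_le {𝔪 κ 𝔫 𝔡 m k : ℕ} (hm : m = 2 ^ 𝔪) (hk : k + 1 = 2 ^ (κ + 1)) :
    ((padeLayout 𝔪 κ 𝔫 𝔡).size : ℝ) ≤ 32000 * ((k : ℝ) + Real.log ((m : ℝ) * k) ^ 3) := by
  have hl : (padeLayout 𝔪 κ 𝔫 𝔡).lows.length = κ + 1 := by
    rw [padeLayout_lows, length_sysQs]
  have hb : (padeLayout 𝔪 κ 𝔫 𝔡).blockBits.length = κ + 1 + (𝔪 + 1) := by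
    rw [padeLayout_blockBits, length_sysQs]
  have hh : (padeLayout 𝔪 κ 𝔫 𝔡).high.length = 𝔪 := length_sysQs _ _ _ _
  have hκ : 2 ^ κ ≤ k := by
    have := Nat.one_le_two_pow (n := κ)
    rw [pow_succ] at hk
    omega
  have hκ' : (2 : ℝ) ^ κ ≤ k := by exact_mod_cast hκ
  have hsize : ((padeLayout 𝔪 κ 𝔫 𝔡).size : ℝ) ≤
      96 * 2 ^ κ + 1000 * ((κ : ℝ) + 𝔪 + 1) ^ 3 := by
    rw [Layout.size, hl, hb, hh]
    push_cast
    have h1 : (0 : ℝ) ≤ κ := κ.cast_nonneg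
    have h2 : (0 : ℝ) ≤ 𝔪 := 𝔪.cast_nonneg
    rw [pow_add, pow_add]
    have h3 : 0 ≤ (κ : ℝ) * 𝔪 := mul_nonneg h1 h2
    have h4 : 0 ≤ (κ : ℝ) ^ 2 * 𝔪 := by positivity
    have h5 : 0 ≤ (κ : ℝ) * 𝔪 ^ 2 := by positivity
    have h6 : 0 ≤ (κ : ℝ) ^ 3 := by positivity
    have h7 : 0 ≤ (𝔪 : ℝ) ^ 3 := by positivity
    have h8 : 0 ≤ (κ : ℝ) ^ 2 := by positivity
    have h9 : 0 ≤ (𝔪 : ℝ) ^ 2 := by positivity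
    nlinarith
  have hk0 : (0 : ℝ) < 2 ^ κ := by positivity
  -- Here `m k ≥ 2 ^ (κ + 𝔪)`, and `log 2 > 1/2`.
  have hlog : ((κ : ℝ) + 𝔪) / 2 ≤ Real.log ((m : ℝ) * k) := by
    have h1 : (2 : ℝ) ^ (κ + 𝔪) ≤ m * k := by
      rw [hm, pow_add, mul_comm]
      push_cast
      gcongr
    have h2 := Real.log_le_log (by positivity) h1
    rw [Real.log_pow] at h2
    have h3 := Real.log_two_gt_d9
    push_cast at h2
    have h4 : (0 : ℝ) ≤ (κ : ℝ) + 𝔪 := by positivity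
    nlinarith
  have ha : (0 : ℝ) ≤ (κ : ℝ) + 𝔪 := by positivity
  have hcube : ((κ : ℝ) + 𝔪) ^ 3 ≤ 8 * Real.log ((m : ℝ) * k) ^ 3 := by
    calc ((κ : ℝ) + 𝔪) ^ 3 = 8 * (((κ : ℝ) + 𝔪) / 2) ^ 3 := by ring
      _ ≤ _ := by gcongr
  have hone : (1 : ℝ) ≤ k := by exact_mod_cast Nat.one_le_two_pow.trans hκ
  -- The difference of the two sides is `3 (a - 1)² (a + 1)`.
  have hpoly : ((κ : ℝ) + 𝔪 + 1) ^ 3 ≤ 4 * (((κ : ℝ) + 𝔪) ^ 3 + 1) := by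
    generalize (κ : ℝ) + 𝔪 = a at ha
    nlinarith [mul_nonneg (sq_nonneg (a - 1)) (add_nonneg ha zero_le_one)]
  linarith

/-! ### Assembly: the entries of the circuit operator. -/

lemma setSel_basisState {𝔪 κ 𝔫 𝔡 : ℕ} (u : Fin (𝔡 + 5) → Fin 2) (X : ℕ) (a b : Fin 2) :
    (padeLayout 𝔪 κ 𝔫 𝔡).setSel (basisState u X) a b =
      basisState (Function.update (Function.update u (Fin.natAdd 𝔡 0) a) (Fin.natAdd 𝔡 1) b) X := by
  change Function.update (Function.update (Sum.elim u _) (.inl (Fin.natAdd 𝔡 0)) a)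
    (.inl (Fin.natAdd 𝔡 1)) b = Sum.elim _ _
  rw [Sum.update_elim_inl, Sum.update_elim_inl]

lemma elim_eq_basisState {d s : ℕ} (x : Fin s → Fin 2) :
    (Sum.elim (fun _ => 0) x : Fin (d + 5) ⊕ Fin s → Fin 2) =
      basisState (fun _ => 0) (finFunctionFinEquiv x).val := by
  conv_lhs => rw [← finFunctionFinEquiv.symm_apply_apply x]
  rfl

lemma innerState_eq_elim {𝔡 𝔫 X : ℕ} (i : Fin (2 ^ 𝔫)) (hi : X % 2 ^ 𝔫 = i.val) :
    innerState 𝔡 𝔫 X = Sum.elim (fun _ => 0) (finFunctionFinEquiv.symm i) := by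
  change Sum.elim _ _ = Sum.elim _ _
  congr 1
  funext j
  apply Fin.ext
  change X / 2 ^ j.val % 2 = i.val / 2 ^ j.val % 2
  have h : X.testBit j = i.val.testBit j := by
    rw [← hi, Nat.testBit_mod_two_pow]; simp
  rw [Nat.testBit_eq_decide_div_mod_eq, Nat.testBit_eq_decide_div_mod_eq, decide_eq_decide] at h
  omega

/-- The operator of the circuit encodes `L_{m,k,p}`. -/
lemma total_apply_eq {𝔪 κ 𝔫 𝔡 k : ℕ} (hk : k + 1 = 2 ^ (κ + 1)) {α h : ℝ} (hα : 0 ≤ α) (hh : 0 < h)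
    {A : Matrix (Fin (2 ^ 𝔫)) (Fin (2 ^ 𝔫)) ℂ} {U : QubitOp (Fin 𝔡 ⊕ Fin 𝔫)}
    (hU : IsBlockEncoding α 𝔡 𝔫 U A)
    (hN : 2 ^ (numSys 𝔪 κ 𝔫) = (2 ^ 𝔪 * (k + 1) + 2 ^ 𝔪 * (k + 1)) * 2 ^ 𝔫)
    (x y : Fin (numSys 𝔪 κ 𝔫) → Fin 2) :
    padeL (2 ^ 𝔪) k (2 ^ 𝔪 * (k + 1)) ((h : ℂ) • A) (finCongr hN (finFunctionFinEquiv x))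
      (finCongr hN (finFunctionFinEquiv y)) =
    ((4 * max (α * h) 1 : ℝ) : ℂ) * (padeLayout 𝔪 κ 𝔫 𝔡).total
      (padeCoeff (max (α * h) 1) (α * h) k) U (Sum.elim (fun _ => 0) x) (Sum.elim (fun _ => 0) y) := by
  obtain ⟨-, -, hn, hA⟩ := hU
  set M := max (α * h) 1 with hMdef
  have hM : 1 ≤ M := le_max_right _ _
  have hM0 : (M : ℂ) ≠ 0 := by
    rw [Complex.ofReal_ne_zero]; linarith
  have hc := abs_padeCoeff_le hM (mul_nonneg hα hh.le) (le_max_left _ _) k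
  have heven : Even (k + 1) := by rw [hk, pow_succ]; exact even_two.mul_left _
  set X := finFunctionFinEquiv x with hX
  set Y := finFunctionFinEquiv y with hY
  obtain ⟨⟨B, i⟩, hBi⟩ := (padeLIndex (2 ^ 𝔪) k (2 ^ 𝔪 * (k + 1)) (2 ^ 𝔫)).surjective (finCongr hN X)
  obtain ⟨⟨B', i'⟩, hBi'⟩ :=
    (padeLIndex (2 ^ 𝔪) k (2 ^ 𝔪 * (k + 1)) (2 ^ 𝔫)).surjective (finCongr hN Y)
  have hval : X.val = blockNum (2 ^ 𝔪) k (2 ^ 𝔪 * (k + 1)) B * 2 ^ 𝔫 + i.val := by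
    rw [← padeLIndex_val, hBi]; rfl
  have hval' : Y.val = blockNum (2 ^ 𝔪) k (2 ^ 𝔪 * (k + 1)) B' * 2 ^ 𝔫 + i'.val := by
    rw [← padeLIndex_val, hBi']; rfl
  have hn0 : 0 < 2 ^ 𝔫 := by positivity
  have hdiv : X.val / 2 ^ 𝔫 = blockNum (2 ^ 𝔪) k (2 ^ 𝔪 * (k + 1)) B := by
    rw [hval, mul_comm, Nat.mul_add_div hn0, Nat.div_eq_of_lt i.2, add_zero]
  have hdiv' : Y.val / 2 ^ 𝔫 = blockNum (2 ^ 𝔪) k (2 ^ 𝔪 * (k + 1)) B' := by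
    rw [hval', mul_comm, Nat.mul_add_div hn0, Nat.div_eq_of_lt i'.2, add_zero]
  have hmod : X.val % 2 ^ 𝔫 = i.val := by rw [hval, Nat.mul_add_mod', Nat.mod_eq_of_lt i.2]
  have hmod' : Y.val % 2 ^ 𝔫 = i'.val := by rw [hval', Nat.mul_add_mod', Nat.mod_eq_of_lt i'.2]
  -- Together with `h` this gives the weight `α h` that the coefficient of the query already
  -- contains. Nothing is divided by `α`, so `α = 0` is allowed.
  have hA' : A i i' = α * U (innerState 𝔡 𝔫 X.val) (innerState 𝔡 𝔫 Y.val) := by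
    rw [innerState_eq_elim i hmod, innerState_eq_elim i' hmod', ← hA]
    simp
  have hu : ∀ (a b : Fin 2) (j : Fin 𝔡), Function.update (Function.update
      (fun _ : Fin (𝔡 + 5) => (0 : Fin 2)) (Fin.natAdd 𝔡 0) a) (Fin.natAdd 𝔡 1) b
      (Fin.castAdd 5 j) = 0 := fun a b j => by
    rw [Function.update_of_ne, Function.update_of_ne]
    · simp only [ne_eq, Fin.ext_iff, Fin.val_castAdd, Fin.val_natAdd]; omega
    · simp only [ne_eq, Fin.ext_iff, Fin.val_castAdd, Fin.val_natAdd]; omega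
  have hu0 : ∀ a b : Fin 2, Function.update (Function.update
      (fun _ : Fin (𝔡 + 5) => (0 : Fin 2)) (Fin.natAdd 𝔡 0) a) (Fin.natAdd 𝔡 1) b
      (Fin.natAdd 𝔡 0) = a := fun a b => by
    rw [Function.update_of_ne (by simp [Fin.ext_iff]), Function.update_self]
  have hu1 : ∀ a b : Fin 2, Function.update (Function.update
      (fun _ : Fin (𝔡 + 5) => (0 : Fin 2)) (Fin.natAdd 𝔡 0) a) (Fin.natAdd 𝔡 1) b
      (Fin.natAdd 𝔡 1) = b := fun a b => by
    rw [Function.update_self]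
  rw [elim_eq_basisState, elim_eq_basisState,
    (padeLayout 𝔪 κ 𝔫 𝔡).total_apply hc U ⟨rfl, rfl, rfl, rfl⟩ ⟨rfl, rfl, rfl, rfl⟩]
  simp only [setSel_basisState, ← hX, ← hY]
  rw [coeff_mul_embedOp hk X.2 Y.2 (hu 0 0) (hu0 0 0) (hu1 0 0),
    coeff_mul_rot_zero hk X.2 Y.2 (hu0 1 0) (hu1 1 0),
    coeff_mul_permOp hk X.2 Y.2 (hu0 0 1) (hu1 0 1),
    coeff_mul_permOp_rot_one hk X.2 Y.2 (hu0 1 1) (hu1 1 1)]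
  simp only [padeL, Matrix.of_apply, ← hBi, ← hBi', Equiv.symm_apply_apply]
  rw [padeLBlock_apply heven, hdiv, hdiv', hmod, hmod', Matrix.smul_apply, hA']
  simp only [Fin.val_inj, smul_eq_mul]
  push_cast
  by_cases hii : i = i'
  · simp only [hii, if_true]
    field_simp
    ring
  · simp only [hii, if_false]
    field_simp
    ring

end PadeCircuit

theorem theorem3p8 :
    ∃ (C : ℝ) (e : ℕ),
      ∀ (𝔪 𝔨 𝔫 𝔡 m k p n : ℕ), m = 2 ^ 𝔪 → k + 1 = 2 ^ 𝔨 → n = 2 ^ 𝔫 → p = m * (k + 1) → 1 ≤ k →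
      ∀ (α h : ℝ), 0 ≤ α → 0 < h →
        ∃ circ : List (CircuitStep (Fin (𝔡 + 5) ⊕ Fin (1 + 𝔪 + 𝔨 + 𝔫)) (Fin 𝔡 ⊕ Fin 𝔫)),
          queryCount circ = 1 ∧
          (gateCount circ : ℝ) ≤ C * ((k : ℝ) + Real.log ((m : ℝ) * (k : ℝ)) ^ e) ∧
          ∀ (A : Matrix (Fin n) (Fin n) ℂ) (U : QubitOp (Fin 𝔡 ⊕ Fin 𝔫)),
            IsBlockEncoding α 𝔡 𝔫 U A →
              IsBlockEncoding (4 * max (α * h) 1) (𝔡 + 5) (1 + 𝔪 + 𝔨 + 𝔫) (circuitOp U circ)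
                (padeL m k p ((h : ℂ) • A)) := by
  refine ⟨32000, 3, ?_⟩
  rintro 𝔪 𝔨 𝔫 𝔡 m k p n hm hk rfl rfl h1 α h hα hh
  -- From `k ≥ 1` there is at least one low qubit, so `low₀` exists and `k + 1` is even.
  obtain ⟨κ, rfl⟩ : ∃ κ, 𝔨 = κ + 1 := by
    refine ⟨𝔨 - 1, ?_⟩
    rcases Nat.eq_zero_or_pos 𝔨 with h0 | h0
    · subst h0; simp at hk; omega
    · omega
  obtain ⟨circ, hq, hg, hop⟩ := (PadeCircuit.padeLayout 𝔪 κ 𝔫 𝔡).exists_circuit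
    (PadeCircuit.padeCoeff (max (α * h) 1) (α * h) k)
  refine ⟨circ, hq, ?_, fun A U hU => ⟨by positivity, ?_, ?_⟩⟩
  · exact (Nat.cast_le.2 hg).trans (PadeCircuit.size_padeLayout_le hm hk)
  · exact PadeCircuit.circuitOp_mem hU.2.1 circ
  · subst hm
    have hN : 2 ^ (1 + 𝔪 + (κ + 1) + 𝔫) = (2 ^ 𝔪 * (k + 1) + 2 ^ 𝔪 * (k + 1)) * 2 ^ 𝔫 := by
      rw [hk]; ring
    refine ⟨hN, fun x y => ?_⟩
    rw [hop]
    exact PadeCircuit.total_apply_eq hk hα hh hU hN x y
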